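/- For $s>0$ and $1\le q<\infty$, let $W^{s,q}(\mathbb R^n)$, $n\ge 1$, be the space of all functions $f\in L^q(\mathbb R^n)$ such that $(I-\Delta)^{s/2}f=\mathscr F^{-1}\big((1+4\pi^2|\xi|^2)^{s/2}\,\mathscr F f\big)$, taken in the sense of tempered distributions with $\mathscr F f(\xi)=\int_{\mathbb R^n} e^{-2\pi i x\cdot\xi}f(x)\,dx$, belongs to $L^q(\mathbb R^n)$, with norm $\|f\|_{W^{s,q}}=\|(I-\Delta)^{s/2}f\|_{L^q}$. For $\delta\in\mathbb C$ let $(1-|x|^2)_+^\delta$ denote the function equal to $(1-|x|^2)^\delta$ for $|x|<1$ and to $0$ for $|x|\ge 1$. Let $n\ge 1$, $1\le q<\infty$ and $s>0$. (i) If $\delta=\sigma+i\tau$ with $\sigma,\tau\in\mathbb R$ and $s<\sigma+\frac1q$, then $(1-|x|^2)_+^\delta\in W^{s,q}(\mathbb R^n)$. (ii) There is a constant $c>0$, depending only on $n$, $q$ and $s$, such that for all real $\sigma_0>s-\frac1q$ and $c'$ there is a constant $C>0$, depending only on $n$, $q$, $s$, $\sigma_0$ and $c'$, with $$\big\|(1-|x|^2)_+^{\sigma+i\tau}\big\|_{W^{s,q}(\mathbb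 R^n)}\le C\,e^{c|\tau|}\qquad\text{for all } \sigma\in[\sigma_0,c'] \text{ and } \tau\in\mathbb R.$$ -/

import Mathlib

open MeasureTheory
open scoped ENNReal SchwartzMap

noncomputable section

namespace BochnerRiesz

/-- The symbol `(1 + 4π²|ξ|²)^{s/2}` on `ℝⁿ`. -/
def besselSymbol (n : ℕ) (s : ℝ) (ξ : EuclideanSpace ℝ (Fin n)) : ℝ :=
  (1 + 4 * Real.pi ^ 2 * ‖ξ‖ ^ 2) ^ (s / 2)

/-- The symbol is smooth with polynomially bounded derivatives, so that Mathlib's Fourier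
multiplier with this symbol is the genuine one (it is zero for symbols without this property). -/
theorem besselSymbol_hasTemperateGrowth (n : ℕ) (s : ℝ) :
    (fun ξ ↦ (besselSymbol n s ξ : ℂ)).HasTemperateGrowth := by
  have h1 := Function.hasTemperateGrowth_one_add_norm_sq_rpow (EuclideanSpace ℝ (Fin n)) (s / 2)
  have h2 : (fun ξ : EuclideanSpace ℝ (Fin n) ↦ (2 * Real.pi) • ξ).HasTemperateGrowth :=
    ((2 * Real.pi) • ContinuousLinearMap.id ℝ (EuclideanSpace ℝ (Fin n))).hasTemperateGrowth
  have h3 := h1.comp h2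
  have h4 : ((fun x : EuclideanSpace ℝ (Fin n) ↦ (1 + ‖x‖ ^ 2) ^ (s / 2)) ∘
      fun ξ ↦ (2 * Real.pi) • ξ) = besselSymbol n s := by
    funext ξ
    simp only [Function.comp, besselSymbol, norm_smul, mul_pow, Real.norm_eq_abs, sq_abs]
    norm_num
  rw [h4] at h3
  fun_prop

/-- The operator `(I - Δ)^{s/2} u = 𝓕⁻¹ ((1 + 4π²|ξ|²)^{s/2} 𝓕 u)` on tempered distributions
on `ℝⁿ`, with `𝓕 f(ξ) = ∫ e^{-2πi x·ξ} f(x) dx`. -/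
def besselOp (n : ℕ) (s : ℝ) :
    𝓢'(EuclideanSpace ℝ (Fin n), ℂ) →L[ℂ] 𝓢'(EuclideanSpace ℝ (Fin n), ℂ) :=
  TemperedDistribution.fourierMultiplierCLM ℂ (fun ξ ↦ (besselSymbol n s ξ : ℂ))

/-- `f` is a function in `L^q(ℝⁿ)` and `(I - Δ)^{s/2} f`, computed in the sense of tempered
distributions, is the `L^q` function `g`. -/
def IsBesselImage (n : ℕ) (s : ℝ) (q : ℝ≥0∞) [Fact (1 ≤ q)]
    (f : EuclideanSpace ℝ (Fin n) → ℂ)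
    (g : Lp ℂ q (volume : Measure (EuclideanSpace ℝ (Fin n)))) : Prop :=
  ∃ hf : MemLp f q volume,
    besselOp n s (Lp.toTemperedDistribution (hf.toLp f)) = Lp.toTemperedDistribution g

/-- Membership of a function in the Sobolev space `W^{s,q}(ℝⁿ)`, for `s ≥ 0`
(for these `s` every element of the space is a function in `L^q`). -/
def MemSobolevW (n : ℕ) (s : ℝ) (q : ℝ≥0∞) [Fact (1 ≤ q)]
    (f : EuclideanSpace ℝ (Fin n) → ℂ) : Prop :=
  ∃ g : Lp ℂ q (volume : Measure (EuclideanSpace ℝ (Fin n))), IsBesselImage n s q f g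

/-- The norm `‖f‖_{W^{s,q}} = ‖(I - Δ)^{s/2} f‖_{L^q}`, with value `∞` if `f ∉ W^{s,q}(ℝⁿ)`.
The infimum is over at most one `g`, see `sobolevNormW_eq`. -/
def sobolevNormW (n : ℕ) (s : ℝ) (q : ℝ≥0∞) [Fact (1 ≤ q)]
    (f : EuclideanSpace ℝ (Fin n) → ℂ) : ℝ≥0∞ :=
  ⨅ (g : Lp ℂ q (volume : Measure (EuclideanSpace ℝ (Fin n)))) (_ : IsBesselImage n s q f g), ‖g‖ₑ

theorem sobolevNormW_eq {n : ℕ} {s : ℝ} {q : ℝ≥0∞} [Fact (1 ≤ q)]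
    {f : EuclideanSpace ℝ (Fin n) → ℂ}
    {g : Lp ℂ q (volume : Measure (EuclideanSpace ℝ (Fin n)))} (hg : IsBesselImage n s q f g) :
    sobolevNormW n s q f = ‖g‖ₑ := by
  apply le_antisymm (iInf₂_le g hg)
  refine le_iInf₂ fun g' hg' ↦ ?_
  obtain ⟨_, h⟩ := hg
  obtain ⟨_, h'⟩ := hg'
  have hinj := LinearMap.ker_eq_bot.mp
    (Lp.ker_toTemperedDistributionCLM_eq_bot (F := ℂ) (p := q)
      (μ := (volume : Measure (EuclideanSpace ℝ (Fin n)))))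
  have : g = g' := hinj (h.symm.trans h')
  rw [this]

/-- The function `(1 - |x|²)_+^δ` on `ℝⁿ`: equal to `(1 - |x|²)^δ = e^{δ log (1 - |x|²)}` for
`|x| < 1` and to `0` for `|x| ≥ 1` (also when `δ = 0`). -/
def ballPower (n : ℕ) (δ : ℂ) (x : EuclideanSpace ℝ (Fin n)) : ℂ :=
  if ‖x‖ < 1 then ((1 - ‖x‖ ^ 2 : ℝ) : ℂ) ^ δ else 0

end BochnerRiesz

end

/-!
Cut the ball into the shells where `1 - |x|²` is comparable to `ε = 2⁻ᵏ`. On such a shell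
`(1 - |x|²)^δ` equals `ε^δ v^δ`, where `v = (1 - |x|²) / ε` is comparable to `1`. Applying
`ε² (I - Δ)` to a function `v^δ φ(v)` gives a function of the same form whose profile is quadratic
in `δ`, so every power of `I - Δ` costs a factor `((1 + |δ|) / ε)²`. Fractional powers are reached
by subordination: `(I - Δ)^a` is a multiple of `∫₀^∞ t^{-a} (I - Δ) e^{-t(I - Δ)} dt`, the heat
semigroup contracts every `L^q`, and splitting the integral at a time `T` interpolates between `I`
and `I - Δ`. As a shell has volume `≲ ε`, the `k`-th piece has norm
`≲ (1 + |δ|)^s 2^{-k(σ + 1/q - s)}` in `W^{s,q}`, which is the term of a geometric series.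
-/

namespace BochnerRiesz

open FourierTransform

section Convolution

variable {G F : Type*} [AddGroup G] [MeasurableSpace G] [MeasurableSub₂ G] [MeasurableAdd G]
  [NormedAddCommGroup F] [NormedSpace ℝ F] {μ ν : Measure G} [μ.IsAddRightInvariant] [SFinite μ]
  [IsFiniteMeasure ν] {f : G → F}

theorem enorm_integral_rpow_le {Ω : Type*} [MeasurableSpace Ω] {ν : Measure Ω}
    {p : ℝ} (hp : 1 ≤ p) {f : Ω → F} (hf : AEStronglyMeasurable f ν) :
    ‖∫ ω, f ω ∂ν‖ₑ ^ p ≤ ν Set.univ ^ (p - 1) * ∫⁻ ω, ‖f ω‖ₑ ^ p ∂ν := by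
  have hp0 : 0 < p := zero_lt_one.trans_le hp
  have holder := eLpNorm'_le_eLpNorm'_mul_rpow_measure_univ one_pos hp hf
  simp only [eLpNorm'_eq_lintegral_enorm, ENNReal.rpow_one, div_one] at holder
  calc ‖∫ ω, f ω ∂ν‖ₑ ^ p ≤ (∫⁻ ω, ‖f ω‖ₑ ∂ν) ^ p := by
        gcongr
        exact enorm_integral_le_lintegral_enorm f
    _ ≤ ((∫⁻ ω, ‖f ω‖ₑ ^ p ∂ν) ^ (1 / p) * ν Set.univ ^ (1 - 1 / p)) ^ p := by gcongr
    _ = ν Set.univ ^ (p - 1) * ∫⁻ ω, ‖f ω‖ₑ ^ p ∂ν := by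
        rw [ENNReal.mul_rpow_of_nonneg _ _ hp0.le, ← ENNReal.rpow_mul, ← ENNReal.rpow_mul,
          one_div_mul_cancel hp0.ne', ENNReal.rpow_one, sub_mul, one_mul,
          one_div_mul_cancel hp0.ne', mul_comm]

theorem lintegral_enorm_integral_sub_rpow_le {p : ℝ} (hp : 1 ≤ p) (hf : StronglyMeasurable f) :
    ∫⁻ x, ‖∫ y, f (x - y) ∂ν‖ₑ ^ p ∂μ ≤ ν Set.univ ^ p * ∫⁻ x, ‖f x‖ₑ ^ p ∂μ := by
  have hmeas : Measurable fun z : G × G ↦ ‖f (z.1 - z.2)‖ₑ ^ p :=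
    (hf.comp_measurable (measurable_fst.sub measurable_snd)).enorm.pow_const _
  calc ∫⁻ x, ‖∫ y, f (x - y) ∂ν‖ₑ ^ p ∂μ
      ≤ ∫⁻ x, ν Set.univ ^ (p - 1) * ∫⁻ y, ‖f (x - y)‖ₑ ^ p ∂ν ∂μ :=
        lintegral_mono fun x ↦ enorm_integral_rpow_le hp
          (hf.comp_measurable (measurable_const.sub measurable_id)).aestronglyMeasurable
    _ = ν Set.univ ^ (p - 1) * ∫⁻ y, ∫⁻ x, ‖f (x - y)‖ₑ ^ p ∂μ ∂ν := by
        rw [lintegral_const_mul _ hmeas.lintegral_prod_right',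
          lintegral_lintegral_swap hmeas.aemeasurable]
    _ = ν Set.univ ^ (p - 1) * ν Set.univ * ∫⁻ x, ‖f x‖ₑ ^ p ∂μ := by
        simp_rw [lintegral_sub_right_eq_self (fun x ↦ ‖f x‖ₑ ^ p)]
        rw [lintegral_const, mul_comm (lintegral _ _), mul_assoc]
    _ = ν Set.univ ^ p * ∫⁻ x, ‖f x‖ₑ ^ p ∂μ := by
        nth_rw 2 [← ENNReal.rpow_one (ν Set.univ)]
        rw [← ENNReal.rpow_add_of_nonneg _ _ (sub_nonneg.2 hp) zero_le_one, sub_add_cancel]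

theorem eLpNorm_top_integral_sub_le (hf : StronglyMeasurable f) :
    eLpNorm (fun x ↦ ∫ y, f (x - y) ∂ν) ∞ μ ≤ ν Set.univ * eLpNorm f ∞ μ := by
  simp only [eLpNorm_exponent_top]
  have hmeas : MeasurableSet {z : G × G | ‖f (z.1 - z.2)‖ₑ ≤ eLpNormEssSup f μ} :=
    (hf.comp_measurable (measurable_fst.sub measurable_snd)).enorm measurableSet_Iic
  have translate (y : G) : ∀ᵐ x ∂μ, ‖f (x - y)‖ₑ ≤ eLpNormEssSup f μ :=
    (measurePreserving_sub_right μ y).quasiMeasurePreserving.ae (ae_le_eLpNormEssSup (f := f))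
  refine eLpNormEssSup_le_of_ae_enorm_bound ?_
  filter_upwards [(Measure.ae_ae_comm (ν := ν) hmeas).2 (.of_forall translate)] with x hx
  calc ‖∫ y, f (x - y) ∂ν‖ₑ ≤ ∫⁻ y, ‖f (x - y)‖ₑ ∂ν := enorm_integral_le_lintegral_enorm _
    _ ≤ ∫⁻ _, eLpNormEssSup f μ ∂ν := lintegral_mono_ae hx
    _ = ν Set.univ * eLpNormEssSup f μ := by rw [lintegral_const, mul_comm]

theorem eLpNorm_integral_sub_le {q : ℝ≥0∞} (hq : 1 ≤ q) (hf : StronglyMeasurable f) :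
    eLpNorm (fun x ↦ ∫ y, f (x - y) ∂ν) q μ ≤ ν Set.univ * eLpNorm f q μ := by
  rcases eq_or_ne q ∞ with rfl | hq_top
  · exact eLpNorm_top_integral_sub_le hf
  have hq0 : q ≠ 0 := (zero_lt_one.trans_le hq).ne'
  have hp : 1 ≤ q.toReal := by simpa using ENNReal.toReal_mono hq_top hq
  have hp0 : 0 < q.toReal := zero_lt_one.trans_le hp
  rw [eLpNorm_eq_lintegral_rpow_enorm_toReal hq0 hq_top,
    eLpNorm_eq_lintegral_rpow_enorm_toReal hq0 hq_top]
  calc (∫⁻ x, ‖∫ y, f (x - y) ∂ν‖ₑ ^ q.toReal ∂μ) ^ (1 / q.toReal)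
      ≤ (ν Set.univ ^ q.toReal * ∫⁻ x, ‖f x‖ₑ ^ q.toReal ∂μ) ^ (1 / q.toReal) := by
        gcongr
        exact lintegral_enorm_integral_sub_rpow_le hp hf
    _ = ν Set.univ * (∫⁻ x, ‖f x‖ₑ ^ q.toReal ∂μ) ^ (1 / q.toReal) := by
        rw [ENNReal.mul_rpow_of_nonneg _ _ (by positivity), ← ENNReal.rpow_mul,
          mul_one_div_cancel hp0.ne', ENNReal.rpow_one]

end Convolution

section Heat

variable {E : Type*} [NormedAddCommGroup E] [InnerProductSpace ℝ E] [FiniteDimensional ℝ E]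
  [MeasurableSpace E] [BorelSpace E] {F : Type*} [NormedAddCommGroup F] [NormedSpace ℂ F]

theorem integral_fourierInv_sub [CompleteSpace F] (ν : Measure E) [IsFiniteMeasure ν] {g : E → F}
    (hg : Integrable g) (x : E) :
    ∫ y, 𝓕⁻ g (x - y) ∂ν = 𝓕⁻ (fun ξ ↦ charFun ν (-(2 * Real.pi) • ξ) • g ξ) x := by
  have phase (y ξ : E) : (𝐞 (inner ℝ ξ (x - y)) : ℂ) =
      𝐞 (inner ℝ ξ x) * Complex.exp (inner ℝ y (-(2 * Real.pi) • ξ) * Complex.I) := by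
    simp only [Real.fourierChar_apply, inner_sub_right, inner_smul_right, real_inner_comm ξ y,
      ← Complex.exp_add]
    congr 1
    push_cast
    ring
  have hint : Integrable (Function.uncurry fun y ξ : E ↦
      𝐞 (inner ℝ ξ (x - y)) • g ξ) (ν.prod volume) := by
    have hcont : Continuous fun z : E × E ↦ (𝐞 (inner ℝ z.2 (x - z.1)) : ℂ) := by
      simp only [Real.fourierChar_apply]
      fun_prop
    simp only [Circle.smul_def]
    exact (hg.comp_snd ν).bdd_smul 1 hcont.aestronglyMeasurable
      (.of_forall fun _ ↦ (Circle.norm_coe _).le)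
  simp only [Real.fourierInv_eq]
  rw [integral_integral_swap hint]
  congr 1 with ξ
  simp only [Circle.smul_def, phase, mul_smul]
  rw [integral_smul, integral_smul_const, charFun_apply]

theorem fourierInv_add_of_integrable {g h : E → F} (hg : Integrable g) (hh : Integrable h) :
    𝓕⁻ (g + h) = 𝓕⁻ g + 𝓕⁻ h :=
  VectorFourier.fourierIntegral_add Real.continuous_fourierChar
    (by simpa using! continuous_inner.neg) hg hh

theorem fourierInv_const_smul (c : ℂ) (g : E → F) : 𝓕⁻ (c • g) = c • 𝓕⁻ g :=
  VectorFourier.fourierIntegral_const_smul ..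

theorem integrable_charFun_smul (ν : Measure E) [IsFiniteMeasure ν] (c : ℝ) {g : E → F}
    (hg : Integrable g) : Integrable fun ξ ↦ charFun ν (c • ξ) • g ξ :=
  hg.bdd_smul (ν.real Set.univ)
    (measurable_charFun.comp (measurable_const_smul c)).aestronglyMeasurable
    (.of_forall fun _ ↦ norm_charFun_le _)

variable (E) in
/-- The measure whose convolution with a function is the superposition `∫ e^{tΔ} dμ(t)` of the heat
semigroup: the image of `μ` times the standard Gaussian under `(t, z) ↦ √(2t) z`. The time `t` is
meant to be nonnegative. -/
noncomputable def heatMixture (μ : Measure ℝ) : Measure E :=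
  (μ.prod (ProbabilityTheory.stdGaussian E)).map fun w ↦ √(2 * w.1) • w.2

theorem heatMixture_univ (μ : Measure ℝ) :
    heatMixture E μ Set.univ = μ Set.univ := by
  rw [heatMixture, Measure.map_apply (by fun_prop) .univ, Set.preimage_univ, ← Set.univ_prod_univ,
    Measure.prod_prod, measure_univ (μ := ProbabilityTheory.stdGaussian E), mul_one]

variable {μ : Measure ℝ} [IsFiniteMeasure μ]

instance : IsFiniteMeasure (heatMixture E μ) :=
  ⟨heatMixture_univ (E := E) μ ▸ measure_lt_top μ _⟩

theorem charFun_heatMixture (hμ : ∀ᵐ t ∂μ, 0 ≤ t) (ξ : E) :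
    charFun (heatMixture E μ) ξ = (∫ t, Real.exp (-(t * ‖ξ‖ ^ 2)) ∂μ : ℝ) := by
  have gauss (t : ℝ) (ht : 0 ≤ t) :
      ∫ z, Complex.exp (inner ℝ (√(2 * t) • z) ξ * Complex.I) ∂ProbabilityTheory.stdGaussian E =
        Real.exp (-(t * ‖ξ‖ ^ 2)) := by
    have h := ProbabilityTheory.charFun_stdGaussian (√(2 * t) • ξ)
    rw [charFun_apply, norm_smul, Real.norm_of_nonneg (Real.sqrt_nonneg _)] at h
    simp only [inner_smul_left, inner_smul_right] at h ⊢
    refine h.trans ?_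
    rw [← Complex.ofReal_pow, mul_pow, Real.sq_sqrt (by positivity)]
    push_cast
    ring_nf
  rw [charFun_apply, heatMixture, integral_map (by fun_prop) (by fun_prop), integral_prod,
    ← integral_complex_ofReal]
  · refine integral_congr_ae ?_
    filter_upwards [hμ] with t ht
    exact gauss t ht
  · exact .of_bound (C := 1) (by fun_prop) (.of_forall fun w ↦ (Complex.norm_exp_ofReal_mul_I _).le)

/-- The measure `e^{-t} dμ(t)`. -/
noncomputable def expDamped (μ : Measure ℝ) : Measure ℝ :=
  μ.withDensity fun t ↦ ENNReal.ofReal (Real.exp (-t))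

theorem expDamped_univ_le {μ : Measure ℝ} (hμ : ∀ᵐ t ∂μ, 0 ≤ t) :
    expDamped μ Set.univ ≤ μ Set.univ := by
  rw [expDamped, withDensity_apply _ .univ, Measure.restrict_univ, ← lintegral_one]
  refine lintegral_mono_ae ?_
  filter_upwards [hμ] with t ht
  simpa using ht

theorem isFiniteMeasure_expDamped (hμ : ∀ᵐ t ∂μ, 0 ≤ t) : IsFiniteMeasure (expDamped μ) :=
  ⟨(expDamped_univ_le hμ).trans_lt (measure_lt_top μ _)⟩

theorem charFun_heatMixture_expDamped (hμ : ∀ᵐ t ∂μ, 0 ≤ t) (ξ : E) :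
    charFun (heatMixture E (expDamped μ)) (-(2 * Real.pi) • ξ) =
      (∫ t, Real.exp (-(t * (1 + 4 * Real.pi ^ 2 * ‖ξ‖ ^ 2))) ∂μ : ℝ) := by
  have := isFiniteMeasure_expDamped hμ
  have hμ' : ∀ᵐ t ∂expDamped μ, 0 ≤ t := (withDensity_absolutelyContinuous _ _).ae_le hμ
  rw [charFun_heatMixture hμ', expDamped,
    integral_withDensity_eq_integral_toReal_smul (by fun_prop) (by simp)]
  congr 2 with t
  rw [ENNReal.toReal_ofReal (Real.exp_pos _).le, smul_eq_mul, ← Real.exp_add, norm_smul, mul_pow,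
    Real.norm_eq_abs, sq_abs]
  ring_nf

/-- The superposition `∫ e^{-t(I-Δ)} f dμ(t)`, given on the Fourier side by the Laplace transform
of `μ` at the symbol `1 + 4π²|ξ|²` of `I - Δ`. -/
noncomputable def besselSemigroupIntegral (μ : Measure ℝ) (f : E → F) : E → F :=
  𝓕⁻ fun ξ ↦ (∫ t, Real.exp (-(t * (1 + 4 * Real.pi ^ 2 * ‖ξ‖ ^ 2))) ∂μ : ℂ) • 𝓕 f ξ

theorem integrable_besselSemigroupIntegral (hμ : ∀ᵐ t ∂μ, 0 ≤ t) (f : 𝓢(E, F)) :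
    Integrable fun ξ ↦
      (∫ t, Real.exp (-(t * (1 + 4 * Real.pi ^ 2 * ‖ξ‖ ^ 2))) ∂μ : ℂ) • 𝓕 (f : E → F) ξ := by
  have := isFiniteMeasure_expDamped hμ
  simp only [integral_complex_ofReal, ← charFun_heatMixture_expDamped hμ]
  exact integrable_charFun_smul _ _ (𝓕 f).integrable

variable [CompleteSpace F]

theorem besselSemigroupIntegral_eq_integral_sub (hμ : ∀ᵐ t ∂μ, 0 ≤ t) (f : 𝓢(E, F)) :
    besselSemigroupIntegral μ f = fun x ↦ ∫ y, f (x - y) ∂heatMixture E (expDamped μ) := by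
  have := isFiniteMeasure_expDamped hμ
  funext x
  have inversion : 𝓕⁻ (𝓕 (f : E → F)) = f := by
    rw [← SchwartzMap.fourier_coe, ← SchwartzMap.fourierInv_coe, fourierInv_fourier_eq]
  rw [← inversion, integral_fourierInv_sub _ (𝓕 f).integrable, inversion, besselSemigroupIntegral]
  simp only [integral_complex_ofReal, ← charFun_heatMixture_expDamped hμ]

theorem aestronglyMeasurable_besselSemigroupIntegral (hμ : ∀ᵐ t ∂μ, 0 ≤ t) (f : 𝓢(E, F)) :
    AEStronglyMeasurable (besselSemigroupIntegral μ f) := by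
  have := isFiniteMeasure_expDamped hμ
  rw [besselSemigroupIntegral_eq_integral_sub hμ]
  have hmeas : StronglyMeasurable fun z : E × E ↦ f (z.1 - z.2) :=
    (f.continuous.comp (continuous_fst.sub continuous_snd)).stronglyMeasurable
  exact hmeas.integral_prod_right'.aestronglyMeasurable

theorem eLpNorm_besselSemigroupIntegral_le {q : ℝ≥0∞} (hq : 1 ≤ q) (hμ : ∀ᵐ t ∂μ, 0 ≤ t)
    (f : 𝓢(E, F)) :
    eLpNorm (besselSemigroupIntegral μ f) q ≤ μ Set.univ * eLpNorm f q := by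
  have := isFiniteMeasure_expDamped hμ
  rw [besselSemigroupIntegral_eq_integral_sub hμ]
  refine (eLpNorm_integral_sub_le hq f.continuous.stronglyMeasurable).trans ?_
  rw [heatMixture_univ]
  exact mul_le_mul' (expDamped_univ_le hμ) le_rfl

end Heat

section Scalar

open Real Set

theorem integrableOn_Ioi_rpow_mul_exp {T p l : ℝ} (hT : 0 < T) (hl : 0 < l) (hp : p ≤ 0) :
    IntegrableOn (fun t ↦ t ^ p * exp (-(t * l))) (Ioi T) := by
  have dominating : IntegrableOn (fun t ↦ T ^ p * exp (-l * t)) (Ioi T) :=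
    (exp_neg_integrableOn_Ioi T hl).const_mul _
  refine dominating.mono' ?_ ?_
  · exact Measurable.aestronglyMeasurable (by fun_prop)
  · filter_upwards [ae_restrict_mem measurableSet_Ioi] with t ht
    have ht' : T < t := ht
    have ht0 : 0 < t := hT.trans ht'
    rw [norm_of_nonneg (by positivity), show -(t * l) = -l * t by ring]
    exact mul_le_mul_of_nonneg_right (rpow_le_rpow_of_nonpos hT ht'.le hp) (exp_pos _).le

theorem integral_Ioi_rpow_mul_exp_by_parts {a T l : ℝ} (ha : 0 < a) (hT : 0 < T) (hl : 0 < l) :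
    l * ∫ t in Ioi T, t ^ (-a) * exp (-(t * l)) =
      T ^ (-a) * exp (-(T * l)) - a * ∫ t in Ioi T, t ^ (-a - 1) * exp (-(t * l)) := by
  have integrable_pow := integrableOn_Ioi_rpow_mul_exp hT hl (show -a ≤ 0 by linarith)
  have integrable_deriv := integrableOn_Ioi_rpow_mul_exp hT hl (show -a - 1 ≤ 0 by linarith)
  have hasDerivAt_mul : ∀ t ∈ Ici T, HasDerivAt (fun t ↦ t ^ (-a) * exp (-(t * l)))
      (-a * (t ^ (-a - 1) * exp (-(t * l))) - l * (t ^ (-a) * exp (-(t * l)))) t := by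
    intro t ht
    have deriv_exp : HasDerivAt (fun t ↦ exp (-(t * l))) (exp (-(t * l)) * (-(1 * l))) t :=
      (((hasDerivAt_id t).mul_const l).neg).exp
    convert! (hasDerivAt_rpow_const (p := -a) (.inl (hT.trans_le ht).ne')).mul deriv_exp using 1
    ring
  have tendsto_zero :
      Filter.Tendsto (fun t ↦ t ^ (-a) * exp (-(t * l))) Filter.atTop (nhds 0) := by
    have tendsto_exp : Filter.Tendsto (fun t ↦ exp (-(t * l))) Filter.atTop (nhds 0) :=
      tendsto_exp_neg_atTop_nhds_zero.comp (Filter.tendsto_id.atTop_mul_const hl)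
    simpa using (tendsto_rpow_neg_atTop ha).mul tendsto_exp
  have by_parts := integral_Ioi_of_hasDerivAt_of_tendsto' hasDerivAt_mul
    ((integrable_deriv.const_mul (-a)).sub (integrable_pow.const_mul l)) tendsto_zero
  rw [integral_sub (integrable_deriv.const_mul (-a)) (integrable_pow.const_mul l),
    integral_const_mul, integral_const_mul] at by_parts
  linarith

theorem integral_Ioi_zero_rpow_mul_exp {a l : ℝ} (ha1 : a < 1) (hl : 0 < l) :
    ∫ t in Ioi 0, t ^ (-a) * exp (-(t * l)) = (1 / l) ^ (1 - a) * Gamma (1 - a) := by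
  rw [← integral_rpow_mul_exp_neg_mul_Ioi (a := 1 - a) (by linarith) hl]
  congr 1 with t
  rw [mul_comm l t, sub_sub, add_comm a 1, ← sub_sub, sub_self, zero_sub]

theorem integrableOn_Ioi_zero_rpow_mul_exp {a l : ℝ} (ha1 : a < 1) (hl : 0 < l) :
    IntegrableOn (fun t ↦ t ^ (-a) * exp (-(t * l))) (Ioi 0) := by
  by_contra not_integrable
  have integral_pos : 0 < (1 / l) ^ (1 - a) * Gamma (1 - a) :=
    mul_pos (by positivity) (Gamma_pos_of_pos (by linarith))
  rw [← integral_Ioi_zero_rpow_mul_exp ha1 hl, integral_undef not_integrable] at integral_pos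
  exact integral_pos.false

theorem Gamma_mul_rpow_eq {a T l : ℝ} (ha : 0 < a) (ha1 : a < 1) (hT : 0 < T) (hl : 0 < l) :
    Gamma (1 - a) * l ^ a = l * (∫ t in Ioc 0 T, t ^ (-a) * exp (-(t * l))) +
      T ^ (-a) * exp (-(T * l)) - a * ∫ t in Ioi T, t ^ (-a - 1) * exp (-(t * l)) := by
  have total := integral_Ioi_zero_rpow_mul_exp ha1 hl
  have integrable := integrableOn_Ioi_zero_rpow_mul_exp ha1 hl
  rw [← Ioc_union_Ioi_eq_Ioi hT.le, setIntegral_union (Ioc_disjoint_Ioi le_rfl) measurableSet_Ioi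
    (integrable.mono_set Ioc_subset_Ioi_self)
    (integrable.mono_set (Ioi_subset_Ioi hT.le))] at total
  have rpow_eq : l ^ a = l * (1 / l) ^ (1 - a) := by
    rw [one_div, inv_rpow hl.le, ← rpow_neg hl.le, ← rpow_one_add' hl.le (by linarith)]
    ring_nf
  calc Gamma (1 - a) * l ^ a = l * ((1 / l) ^ (1 - a) * Gamma (1 - a)) := by rw [rpow_eq]; ring
    _ = _ := by
      rw [← total, mul_add, integral_Ioi_rpow_mul_exp_by_parts ha hT hl]
      ring

end Scalar

section PowerMeasure

open Real Set

/-- The measure `t^p dt` on a set `S` of positive reals. -/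
noncomputable def rpowMeasure (p : ℝ) (S : Set ℝ) : Measure ℝ :=
  (volume.restrict S).withDensity fun t ↦ ENNReal.ofReal (t ^ p)

variable {p T : ℝ} {S : Set ℝ}

theorem rpowMeasure_univ (hS : MeasurableSet S) (hS0 : S ⊆ Ioi 0)
    (hi : IntegrableOn (fun t ↦ t ^ p) S) :
    rpowMeasure p S univ = ENNReal.ofReal (∫ t in S, t ^ p) := by
  rw [rpowMeasure, withDensity_apply _ .univ, Measure.restrict_univ,
    ofReal_integral_eq_lintegral_ofReal hi]
  filter_upwards [ae_restrict_mem hS] with t ht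
  exact rpow_nonneg (hS0 ht).le p

theorem rpowMeasure_Ioc_univ (hp : -1 < p) (hT : 0 ≤ T) :
    rpowMeasure p (Ioc 0 T) univ = ENNReal.ofReal (T ^ (p + 1) / (p + 1)) := by
  rw [rpowMeasure_univ measurableSet_Ioc Ioc_subset_Ioi_self
    ((intervalIntegrable_iff_integrableOn_Ioc_of_le hT).1
      (intervalIntegral.intervalIntegrable_rpow' hp)), ← intervalIntegral.integral_of_le hT,
    integral_rpow (.inl hp), zero_rpow (by linarith), sub_zero]

theorem rpowMeasure_Ioi_univ (hp : p < -1) (hT : 0 < T) :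
    rpowMeasure p (Ioi T) univ = ENNReal.ofReal (-T ^ (p + 1) / (p + 1)) := by
  rw [rpowMeasure_univ measurableSet_Ioi (Ioi_subset_Ioi hT.le)
    (integrableOn_Ioi_rpow_of_lt hp hT), integral_Ioi_rpow_of_lt hp hT]

theorem isFiniteMeasure_rpowMeasure_Ioc (hp : -1 < p) (hT : 0 ≤ T) :
    IsFiniteMeasure (rpowMeasure p (Ioc 0 T)) :=
  ⟨rpowMeasure_Ioc_univ hp hT ▸ ENNReal.ofReal_lt_top⟩

theorem isFiniteMeasure_rpowMeasure_Ioi (hp : p < -1) (hT : 0 < T) :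
    IsFiniteMeasure (rpowMeasure p (Ioi T)) :=
  ⟨rpowMeasure_Ioi_univ hp hT ▸ ENNReal.ofReal_lt_top⟩

theorem ae_rpowMeasure_nonneg (hS : MeasurableSet S) (hS0 : S ⊆ Ioi 0) :
    ∀ᵐ t ∂rpowMeasure p S, 0 ≤ t := by
  refine (withDensity_absolutelyContinuous _ _).ae_le ?_
  filter_upwards [ae_restrict_mem hS] with t ht
  exact (hS0 ht).le

theorem integral_rpowMeasure (hS : MeasurableSet S) (hS0 : S ⊆ Ioi 0) (g : ℝ → ℝ) :
    ∫ t, g t ∂rpowMeasure p S = ∫ t in S, t ^ p * g t := by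
  rw [rpowMeasure, integral_withDensity_eq_integral_toReal_smul (by fun_prop) (by simp)]
  refine setIntegral_congr_fun hS fun t ht ↦ ?_
  simp only [smul_eq_mul, ENNReal.toReal_ofReal (rpow_nonneg (hS0 ht).le p)]

end PowerMeasure

section Interpolation

open Real Set

variable {n : ℕ}

theorem besselSymbol_two (ξ : EuclideanSpace ℝ (Fin n)) :
    besselSymbol n 2 ξ = 1 + 4 * π ^ 2 * ‖ξ‖ ^ 2 := by
  simp [besselSymbol]

theorem besselSymbol_add (s t : ℝ) (ξ : EuclideanSpace ℝ (Fin n)) :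
    besselSymbol n (s + t) ξ = besselSymbol n s ξ * besselSymbol n t ξ := by
  rw [besselSymbol, besselSymbol, besselSymbol, ← rpow_add (by positivity), add_div]

/-- The operator `(I - Δ)^{s/2}` on Schwartz functions. -/
noncomputable def schwartzBessel (n : ℕ) (s : ℝ) :
    𝓢(EuclideanSpace ℝ (Fin n), ℂ) →L[ℂ] 𝓢(EuclideanSpace ℝ (Fin n), ℂ) :=
  SchwartzMap.fourierMultiplierCLM ℂ (fun ξ ↦ (besselSymbol n s ξ : ℂ))

theorem schwartzBessel_add (s t : ℝ) (f : 𝓢(EuclideanSpace ℝ (Fin n), ℂ)) :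
    schwartzBessel n (s + t) f = schwartzBessel n s (schwartzBessel n t f) := by
  rw [schwartzBessel, schwartzBessel, schwartzBessel,
    SchwartzMap.fourierMultiplierCLM_fourierMultiplierCLM_apply
      (besselSymbol_hasTemperateGrowth n s) (besselSymbol_hasTemperateGrowth n t)]
  congr 2
  funext ξ
  simp [besselSymbol_add]

theorem schwartzBessel_zero (f : 𝓢(EuclideanSpace ℝ (Fin n), ℂ)) :
    schwartzBessel n 0 f = f := by
  simp [schwartzBessel, besselSymbol]

theorem fourier_schwartzBessel (s : ℝ) (f : 𝓢(EuclideanSpace ℝ (Fin n), ℂ))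
    (ξ : EuclideanSpace ℝ (Fin n)) :
    𝓕 (schwartzBessel n s f) ξ = besselSymbol n s ξ * 𝓕 f ξ := by
  have h : 𝓕 (schwartzBessel n s f) =
      SchwartzMap.smulLeftCLM ℂ (fun ξ ↦ (besselSymbol n s ξ : ℂ)) (𝓕 f) := by
    rw [schwartzBessel, SchwartzMap.fourierMultiplierCLM_apply]
    exact FourierTransform.fourier_fourierInv_eq _
  rw [h, SchwartzMap.smulLeftCLM_apply_apply (besselSymbol_hasTemperateGrowth n s), smul_eq_mul]

theorem Gamma_mul_besselSymbol_eq {a T : ℝ} (ha : 0 < a) (ha1 : a < 1) (hT : 0 < T)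
    (ξ : EuclideanSpace ℝ (Fin n)) :
    Gamma (1 - a) * besselSymbol n (2 * a) ξ = besselSymbol n 2 ξ *
      (∫ t, exp (-(t * (1 + 4 * π ^ 2 * ‖ξ‖ ^ 2))) ∂rpowMeasure (-a) (Ioc 0 T)) +
      T ^ (-a) * (∫ t, exp (-(t * (1 + 4 * π ^ 2 * ‖ξ‖ ^ 2))) ∂Measure.dirac T) -
      a * ∫ t, exp (-(t * (1 + 4 * π ^ 2 * ‖ξ‖ ^ 2))) ∂rpowMeasure (-a - 1) (Ioi T) := by
  rw [integral_rpowMeasure measurableSet_Ioc Ioc_subset_Ioi_self,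
    integral_rpowMeasure measurableSet_Ioi (Ioi_subset_Ioi hT.le), integral_dirac, besselSymbol_two,
    ← Gamma_mul_rpow_eq ha ha1 hT (by positivity), besselSymbol, mul_div_cancel_left₀ a two_ne_zero]

theorem Gamma_smul_schwartzBessel_eq {a T : ℝ} (ha : 0 < a) (ha1 : a < 1) (hT : 0 < T)
    (f : 𝓢(EuclideanSpace ℝ (Fin n), ℂ)) :
    (Gamma (1 - a) : ℂ) • (schwartzBessel n (2 * a) f : EuclideanSpace ℝ (Fin n) → ℂ) =
      besselSemigroupIntegral (rpowMeasure (-a) (Ioc 0 T)) (schwartzBessel n 2 f) +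
      (((T ^ (-a) : ℝ) : ℂ) • besselSemigroupIntegral (Measure.dirac T) f +
      ((-a : ℝ) : ℂ) • besselSemigroupIntegral (rpowMeasure (-a - 1) (Ioi T)) f) := by
  have := isFiniteMeasure_rpowMeasure_Ioc (p := -a) (by linarith) hT.le
  have := isFiniteMeasure_rpowMeasure_Ioi (p := -a - 1) (by linarith) hT
  have small := integrable_besselSemigroupIntegral (μ := rpowMeasure (-a) (Ioc 0 T))
    (ae_rpowMeasure_nonneg measurableSet_Ioc Ioc_subset_Ioi_self) (schwartzBessel n 2 f)
  have medium := (integrable_besselSemigroupIntegral (μ := Measure.dirac T) (by simpa using hT.le)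
    f).smul ((T ^ (-a) : ℝ) : ℂ)
  have large := (integrable_besselSemigroupIntegral (μ := rpowMeasure (-a - 1) (Ioi T))
    (ae_rpowMeasure_nonneg measurableSet_Ioi (Ioi_subset_Ioi hT.le)) f).smul ((-a : ℝ) : ℂ)
  have inversion : (schwartzBessel n (2 * a) f : EuclideanSpace ℝ (Fin n) → ℂ) =
    𝓕⁻ (𝓕 (schwartzBessel n (2 * a) f : EuclideanSpace ℝ (Fin n) → ℂ)) := by
    rw [← SchwartzMap.fourier_coe, ← SchwartzMap.fourierInv_coe, fourierInv_fourier_eq]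
  simp only [besselSemigroupIntegral]
  rw [inversion, ← fourierInv_const_smul, ← fourierInv_const_smul, ← fourierInv_const_smul,
    ← fourierInv_add_of_integrable medium large,
    ← fourierInv_add_of_integrable small (medium.add large)]
  congr 1 with ξ
  have key := congrArg (fun r : ℝ ↦ (r : ℂ) * 𝓕 f ξ) (Gamma_mul_besselSymbol_eq ha ha1 hT ξ)
  simp only [← SchwartzMap.fourier_coe, fourier_schwartzBessel, Pi.add_apply, Pi.smul_apply,
    smul_eq_mul, integral_complex_ofReal]
  push_cast at key ⊢
  linear_combination key

/-- Interpolation between `I` and `I - Δ`: splitting the subordination formula for `(I - Δ)^a` at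
the time `T` charges small times to `(I - Δ) f` and large times to `f`. -/
theorem eLpNorm_schwartzBessel_le {a T : ℝ} (ha : 0 < a) (ha1 : a < 1) (hT : 0 < T)
    {q : ℝ≥0∞} (hq : 1 ≤ q) (f : 𝓢(EuclideanSpace ℝ (Fin n), ℂ)) :
    ENNReal.ofReal (Gamma (1 - a)) * eLpNorm (schwartzBessel n (2 * a) f) q ≤
      ENNReal.ofReal (T ^ (1 - a) / (1 - a)) * eLpNorm (schwartzBessel n 2 f) q +
        2 * (ENNReal.ofReal (T ^ (-a)) * eLpNorm f q) := by
  have := isFiniteMeasure_rpowMeasure_Ioc (p := -a) (by linarith) hT.le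
  have := isFiniteMeasure_rpowMeasure_Ioi (p := -a - 1) (by linarith) hT
  have small_nonneg := ae_rpowMeasure_nonneg (p := -a) (S := Ioc 0 T) measurableSet_Ioc
    Ioc_subset_Ioi_self
  have medium_nonneg : ∀ᵐ t ∂Measure.dirac T, 0 ≤ t := by simpa using hT.le
  have large_nonneg := ae_rpowMeasure_nonneg (p := -a - 1) measurableSet_Ioi (Ioi_subset_Ioi hT.le)
  have small := eLpNorm_besselSemigroupIntegral_le hq small_nonneg (schwartzBessel n 2 f)
  have medium := eLpNorm_besselSemigroupIntegral_le hq medium_nonneg f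
  have large := eLpNorm_besselSemigroupIntegral_le hq large_nonneg f
  rw [rpowMeasure_Ioc_univ (by linarith) hT.le, neg_add_eq_sub] at small
  rw [measure_univ, one_mul] at medium
  rw [rpowMeasure_Ioi_univ (by linarith) hT, sub_add_cancel, neg_div_neg_eq] at large
  have enorm_ofReal {r : ℝ} (hr : 0 ≤ r) : ‖(r : ℂ)‖ₑ = ENNReal.ofReal r := by
    rw [← ofReal_norm, Complex.norm_real, norm_of_nonneg hr]
  have measurable_medium :=
    (aestronglyMeasurable_besselSemigroupIntegral medium_nonneg f).const_smul ((T ^ (-a) : ℝ) : ℂ)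
  have measurable_large :=
    (aestronglyMeasurable_besselSemigroupIntegral large_nonneg f).const_smul ((-a : ℝ) : ℂ)
  rw [← enorm_ofReal (Gamma_pos_of_pos (by linarith)).le, ← eLpNorm_const_smul,
    Gamma_smul_schwartzBessel_eq ha ha1 hT, two_mul]
  refine (eLpNorm_add_le (aestronglyMeasurable_besselSemigroupIntegral small_nonneg _)
    (measurable_medium.add measurable_large) hq).trans (add_le_add small
      ((eLpNorm_add_le measurable_medium measurable_large hq).trans (add_le_add ?_ ?_)))
  · rw [eLpNorm_const_smul, enorm_ofReal (by positivity)]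
    gcongr
  · rw [eLpNorm_const_smul, Complex.ofReal_neg, enorm_neg, enorm_ofReal ha.le]
    calc _ ≤ ENNReal.ofReal a * (ENNReal.ofReal (T ^ (-a) / a) * eLpNorm f q) := by gcongr
      _ = _ := by rw [← mul_assoc, ← ENNReal.ofReal_mul ha.le, mul_div_cancel₀ _ ha.ne']

end Interpolation

section EndomorphismPowers

theorem exists_seminorm_sum_smul_pow_le {ι 𝕜 V : Type*} [Fintype ι] [NormedField 𝕜]
    [AddCommGroup V] [Module 𝕜 V] (p : Seminorm 𝕜 V) (L : ι → Module.End 𝕜 V) (j : ℕ) (v : V) :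
    ∃ C : ℝ, ∀ (K : ℝ) (c : ι → 𝕜), (∀ i, ‖c i‖ ≤ K) →
      p (((∑ i, c i • L i) ^ j) v) ≤ C * K ^ j := by
  induction j generalizing v with
  | zero => exact ⟨p v, fun K c _ ↦ by simp⟩
  | succ j ih =>
    choose C hC using fun i ↦ ih (L i v)
    refine ⟨∑ i, C i, fun K c hc ↦ ?_⟩
    calc p (((∑ i, c i • L i) ^ (j + 1)) v)
        = p (∑ i, c i • ((∑ i, c i • L i) ^ j) (L i v)) := by
          simp only [pow_succ, Module.End.mul_apply, LinearMap.sum_apply, LinearMap.smul_apply,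
            map_sum, map_smul]
      _ ≤ ∑ i, p (c i • ((∑ i, c i • L i) ^ j) (L i v)) :=
          Finset.le_sum_of_subadditive p (map_zero p).le (map_add_le_add p) _ _
      _ ≤ ∑ i, K * (C i * K ^ j) := by
          refine Finset.sum_le_sum fun i _ ↦ ?_
          rw [map_smul_eq_mul]
          exact mul_le_mul (hc i) (hC i K c hc) (apply_nonneg p _) ((norm_nonneg _).trans (hc i))
      _ = (∑ i, C i) * K ^ (j + 1) := by
          rw [Finset.sum_mul]
          exact Finset.sum_congr rfl fun i _ ↦ by ring

end EndomorphismPowers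

section Profile

open Set
open scoped ContDiff Distributions

/-- The compact interval `[1/2, 2]`. -/
def dyadicInterval : TopologicalSpace.Compacts ℝ := ⟨Icc (1 / 2) 2, isCompact_Icc⟩

/-- The smooth functions on `ℝ` supported in `[1/2, 2]`: the possible profiles of a function which
lives at distance comparable to `ε` from the unit sphere, in the variable `(1 - |x|²) / ε`. -/
abbrev Profile : Type := 𝓓_{dyadicInterval}(ℝ, ℂ)

namespace Profile

variable {δ : ℂ} {v : ℝ}

theorem pos_of_mem_dyadicInterval (hv : v ∈ dyadicInterval) : 0 < v :=
  one_half_pos.trans_le hv.1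

theorem contDiffAt_ofReal_cpow (δ : ℂ) (hv : 0 < v) :
    ContDiffAt ℝ ∞ (fun v : ℝ ↦ (v : ℂ) ^ δ) v := by
  have analytic : AnalyticAt ℂ (fun z : ℂ ↦ z ^ δ) v :=
    analyticAt_id.cpow analyticAt_const (Complex.ofReal_mem_slitPlane.2 hv)
  exact (analytic.contDiffAt.restrict_scalars ℝ).comp v Complex.ofRealCLM.contDiff.contDiffAt

/-- Multiplication of profiles by `v ^ δ`, which is smooth away from `v = 0`. -/
noncomputable def cpowMul (δ : ℂ) : Module.End ℂ Profile where
  toFun φ :=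
    { toFun v := (v : ℂ) ^ δ * φ v
      contDiff' := by
        refine contDiff_iff_contDiffAt.2 fun v ↦ ?_
        by_cases hv : v ∈ tsupport φ
        · exact (contDiffAt_ofReal_cpow δ
            (pos_of_mem_dyadicInterval (φ.tsupport_subset hv))).mul φ.contDiff.contDiffAt
        · refine contDiffAt_const (c := (0 : ℂ)) |>.congr_of_eventuallyEq ?_
          filter_upwards [notMem_tsupport_iff_eventuallyEq.1 hv] with w hw
          rw [hw, Pi.zero_apply, mul_zero]
      zero_on_compl' v hv := by
        simp only [φ.zero_on_compl hv, Pi.zero_apply, mul_zero] }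
  map_add' φ ψ := by ext v; exact mul_add _ _ _
  map_smul' c φ := by ext v; exact mul_left_comm _ _ _

/-- Differentiation of profiles. -/
noncomputable def derivative : Module.End ℂ Profile where
  toFun φ := .of_support_subset ((contDiff_infty_iff_deriv.1 φ.contDiff).2)
    ((support_deriv_subset).trans φ.tsupport_subset)
  map_add' φ ψ := by
    ext v
    exact deriv_add (φ.contDiff.differentiable (by simp) v) (ψ.contDiff.differentiable (by simp) v)
  map_smul' c φ := by
    ext v
    exact deriv_const_smul c (φ.contDiff.differentiable (by simp) v)

theorem cpowMul_apply (φ : Profile) : cpowMul δ φ v = (v : ℂ) ^ δ * φ v := rfl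

theorem hasDerivAt (φ : Profile) (v : ℝ) : HasDerivAt φ (derivative φ v) v :=
  (φ.contDiff.differentiable (by simp) v).hasDerivAt

theorem ext_of_mem {φ ψ : Profile} (h : ∀ v ∈ dyadicInterval, φ v = ψ v) : φ = ψ := by
  ext v
  by_cases hv : v ∈ dyadicInterval
  · exact h v hv
  · rw [φ.zero_on_compl hv, ψ.zero_on_compl hv]

theorem cpowMul_mul_cpowMul (δ δ' : ℂ) : cpowMul δ * cpowMul δ' = cpowMul (δ + δ') := by
  refine LinearMap.ext fun φ ↦ ext_of_mem fun v hv ↦ ?_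
  have hv' : (v : ℂ) ≠ 0 := Complex.ofReal_ne_zero.2 (pos_of_mem_dyadicInterval hv).ne'
  rw [Module.End.mul_apply, cpowMul_apply, cpowMul_apply, cpowMul_apply, Complex.cpow_add _ _ hv',
    mul_assoc]

/-- Differentiation conjugated by multiplication by `v ^ δ`. -/
noncomputable def twistedDerivative (δ : ℂ) : Module.End ℂ Profile := δ • cpowMul (-1) + derivative

theorem semiconjBy_cpowMul_derivative (δ : ℂ) :
    SemiconjBy (cpowMul δ) (twistedDerivative δ) derivative := by
  refine LinearMap.ext fun φ ↦ ext_of_mem fun v hv ↦ ?_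
  have hv₀ := pos_of_mem_dyadicInterval hv
  have hv' : (v : ℂ) ≠ 0 := Complex.ofReal_ne_zero.2 hv₀.ne'
  have power : HasDerivAt (fun v : ℝ ↦ (v : ℂ) ^ δ) (δ * (v : ℂ) ^ (δ - 1) * 1) v :=
    ((hasDerivAt_id (v : ℂ)).cpow_const (Or.inl (by simpa using hv₀))).comp_ofReal
  refine Eq.trans ?_ (power.mul (hasDerivAt φ v)).deriv.symm
  change (v : ℂ) ^ δ * (δ * ((v : ℂ) ^ (-1 : ℂ) * φ v) + derivative φ v) = _
  rw [Complex.cpow_sub _ _ hv', Complex.cpow_neg_one, Complex.cpow_one]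
  ring

/-- For `A = d/dv`, the operator which `ε² (I - Δ)` induces in dimension `d` on the profile of a
function of `v = (1 - |x|²) / ε`. -/
noncomputable def scaledBessel (d : ℕ) (ε : ℝ) (A : Module.End ℂ Profile) : Module.End ℂ Profile :=
  ((ε : ℂ) ^ 2) • 1 - (4 : ℂ) • A ^ 2 +
    (ε : ℂ) • ((4 : ℂ) • (cpowMul 1 * A ^ 2) + (2 * d : ℂ) • A)

theorem scaledBessel_apply (d : ℕ) (ε : ℝ) (A : Module.End ℂ Profile) (φ : Profile) (v : ℝ) :
    scaledBessel d ε A φ v = ε ^ 2 * φ v - 4 * A (A φ) v +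
      ε * (4 * (v * A (A φ) v) + 2 * d * A φ v) := by
  rw [scaledBessel, sq A]
  conv_rhs => rw [← Complex.cpow_one (v : ℂ)]
  rfl

theorem semiconjBy_cpowMul_scaledBessel (d : ℕ) (δ : ℂ) (ε : ℝ) :
    SemiconjBy (cpowMul δ) (scaledBessel d ε (twistedDerivative δ))
      (scaledBessel d ε derivative) := by
  have comm : cpowMul δ * cpowMul 1 = cpowMul 1 * cpowMul δ := by
    rw [cpowMul_mul_cpowMul, cpowMul_mul_cpowMul, add_comm]
  have first := semiconjBy_cpowMul_derivative δ
  have second := first.pow_right 2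
  have second' : SemiconjBy (cpowMul δ) _ _ := SemiconjBy.mul_right comm second
  simp only [SemiconjBy] at first second second' ⊢
  simp only [scaledBessel, mul_add, add_mul, mul_sub, sub_mul, mul_smul_comm, smul_mul_assoc,
    mul_one, one_mul, first, second, second']

theorem exists_scaledBessel_twistedDerivative_eq_sum (d : ℕ) :
    ∃ L : Fin 7 → Module.End ℂ Profile, ∀ (δ : ℂ) (ε : ℝ),
      scaledBessel d ε (twistedDerivative δ) =
        ∑ i, (![1, δ, δ ^ 2, ε, ε * δ, ε * δ ^ 2, ε ^ 2] : Fin 7 → ℂ) i • L i := by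
  refine ⟨![-(4 : ℂ) • derivative ^ 2,
    -(4 : ℂ) • (cpowMul (-1) * derivative + derivative * cpowMul (-1)),
    -(4 : ℂ) • cpowMul (-1) ^ 2,
    (4 : ℂ) • (cpowMul 1 * derivative ^ 2) + (2 * d : ℂ) • derivative,
    (4 : ℂ) • (cpowMul 1 * (cpowMul (-1) * derivative + derivative * cpowMul (-1))) +
      (2 * d : ℂ) • cpowMul (-1),
    (4 : ℂ) • (cpowMul 1 * cpowMul (-1) ^ 2), 1], fun δ ε ↦ ?_⟩
  simp only [scaledBessel, twistedDerivative, Fin.sum_univ_seven, Matrix.cons_val, sq, mul_add,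
    add_mul, smul_mul_assoc, mul_smul_comm, smul_add, smul_smul]
  module

theorem exists_seminorm_scaledBessel_pow_le (p : Seminorm ℂ Profile) (d j : ℕ) (φ : Profile) :
    ∃ C : ℝ, ∀ (δ : ℂ) (ε : ℝ), 0 ≤ ε → ε ≤ 1 →
      p ((scaledBessel d ε (twistedDerivative δ) ^ j) φ) ≤ C * (1 + ‖δ‖) ^ (2 * j) := by
  obtain ⟨L, hL⟩ := exists_scaledBessel_twistedDerivative_eq_sum d
  obtain ⟨C, hC⟩ := exists_seminorm_sum_smul_pow_le p L j φ
  refine ⟨C, fun δ ε hε hε₁ ↦ ?_⟩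
  rw [hL, pow_mul]
  refine hC _ _ fun i ↦ ?_
  have one_le : 1 ≤ (1 + ‖δ‖) ^ 2 := one_le_pow₀ (le_add_of_nonneg_right (norm_nonneg δ))
  have norm_le : ‖δ‖ ≤ (1 + ‖δ‖) ^ 2 := by nlinarith [norm_nonneg δ]
  have sq_le : ‖δ‖ ^ 2 ≤ (1 + ‖δ‖) ^ 2 := by nlinarith [norm_nonneg δ]
  have eps_mul_le {r : ℝ} (hr : 0 ≤ r) : ε * r ≤ r := mul_le_of_le_one_left hr hε₁
  fin_cases i <;> simp only [Fin.reduceFinMk, Matrix.cons_val, norm_mul, norm_pow, norm_one,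
    Complex.norm_real, Real.norm_of_nonneg hε, Fin.zero_eta, Fin.mk_one]
  · exact one_le
  · exact norm_le
  · exact sq_le
  · exact hε₁.trans one_le
  · exact (eps_mul_le (norm_nonneg δ)).trans norm_le
  · exact (eps_mul_le (sq_nonneg _)).trans sq_le
  · exact (pow_le_one₀ hε hε₁).trans one_le

theorem rpow_le_two_rpow_abs (hv : v ∈ dyadicInterval) (σ : ℝ) : v ^ σ ≤ 2 ^ |σ| := by
  have hv₀ := pos_of_mem_dyadicInterval hv
  rcases le_total 0 σ with hσ | hσ
  · rw [abs_of_nonneg hσ]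
    exact Real.rpow_le_rpow hv₀.le hv.2 hσ
  · rw [abs_of_nonpos hσ, Real.rpow_neg zero_le_two, ← Real.inv_rpow zero_le_two, ← one_div]
    exact Real.rpow_le_rpow_of_nonpos one_half_pos hv.1 hσ

theorem seminorm_cpowMul_le (δ : ℂ) (φ : Profile) :
    N[ℂ]_{dyadicInterval, 0} (cpowMul δ φ) ≤ 2 ^ |δ.re| * N[ℂ]_{dyadicInterval, 0} φ := by
  rw [ContDiffMapSupportedIn.seminorm_top_le_iff ℂ (by positivity)]
  intro v hv
  rw [norm_iteratedFDeriv_zero, cpowMul_apply, norm_mul,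
    Complex.norm_cpow_eq_rpow_re_of_pos (pos_of_mem_dyadicInterval hv)]
  gcongr
  · exact rpow_le_two_rpow_abs hv _
  · exact ContDiffMapSupportedIn.norm_apply_le_seminorm ℂ

end Profile

end Profile

section Laplacian

open scoped Laplacian LineDeriv

variable {E : Type*} [NormedAddCommGroup E] [InnerProductSpace ℝ E] {F F' F'' : ℝ → ℂ}

theorem hasFDerivAt_comp_norm_sq {c : ℂ} {x : E} (hF : HasDerivAt F c (‖x‖ ^ 2)) :
    HasFDerivAt (fun y : E ↦ F (‖y‖ ^ 2)) ((2 • innerSL ℝ x).smulRight c) x := by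
  convert! hF.hasFDerivAt.comp x (hasStrictFDerivAt_norm_sq x).hasFDerivAt

theorem lineDeriv_of_forall_eq_comp_norm_sq {f : 𝓢(E, ℂ)} (hf : ∀ x, f x = F (‖x‖ ^ 2))
    (hF : ∀ r, HasDerivAt F (F' r) r) (m x : E) :
    ∂_{m} f x = 2 * inner ℝ x m * F' (‖x‖ ^ 2) := by
  rw [SchwartzMap.lineDerivOp_apply_eq_fderiv, funext hf, (hasFDerivAt_comp_norm_sq (hF _)).fderiv]
  simp

theorem lineDeriv_lineDeriv_of_forall_eq_comp_norm_sq {f : 𝓢(E, ℂ)}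
    (hf : ∀ x, f x = F (‖x‖ ^ 2)) (hF : ∀ r, HasDerivAt F (F' r) r)
    (hF' : ∀ r, HasDerivAt F' (F'' r) r) (m x : E) :
    ∂_{m} (∂_{m} f) x =
      4 * (inner ℝ x m ^ 2 : ℝ) * F'' (‖x‖ ^ 2) + 2 * (‖m‖ ^ 2 : ℝ) * F' (‖x‖ ^ 2) := by
  have linear : HasFDerivAt (fun y : E ↦ (2 * (inner ℝ y m : ℝ) : ℂ))
      ((2 : ℂ) • (Complex.ofRealCLM ∘L innerSL ℝ m)) x := by
    convert! ((Complex.ofRealCLM ∘L innerSL ℝ m).hasFDerivAt (x := x)).const_mul (2 : ℂ) using 3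
    simp [real_inner_comm]
  rw [SchwartzMap.lineDerivOp_apply_eq_fderiv,
    funext (lineDeriv_of_forall_eq_comp_norm_sq hf hF m),
    (linear.fun_mul (hasFDerivAt_comp_norm_sq (hF' _))).fderiv]
  simp only [add_apply, smul_apply, ContinuousLinearMap.smulRight_apply, coe_innerSL_apply,
    nsmul_eq_mul, Nat.cast_ofNat, Complex.real_smul, Complex.ofReal_mul, Complex.ofReal_ofNat,
    smul_eq_mul, ContinuousLinearMap.comp_apply, inner_self_eq_norm_sq_to_K, Real.ringHom_apply,
    Complex.ofRealCLM_apply, Complex.ofReal_pow]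
  ring

theorem laplacian_of_forall_eq_comp_norm_sq [FiniteDimensional ℝ E] {f : 𝓢(E, ℂ)}
    (hf : ∀ x, f x = F (‖x‖ ^ 2))
    (hF : ∀ r, HasDerivAt F (F' r) r) (hF' : ∀ r, HasDerivAt F' (F'' r) r) (x : E) :
    Δ f x = 4 * (‖x‖ ^ 2 : ℝ) * F'' (‖x‖ ^ 2) + 2 * Module.finrank ℝ E * F' (‖x‖ ^ 2) := by
  rw [SchwartzMap.laplacian_eq_sum (stdOrthonormalBasis ℝ E), _root_.sum_apply]
  simp only [lineDeriv_lineDeriv_of_forall_eq_comp_norm_sq hf hF hF', Finset.sum_add_distrib,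
    ← Finset.sum_mul, ← Finset.mul_sum, ← Complex.ofReal_sum, OrthonormalBasis.sum_sq_inner_left]
  simp

end Laplacian

section Annulus

open Set Profile
open scoped ContDiff Distributions Laplacian

variable {E : Type*} [NormedAddCommGroup E] [InnerProductSpace ℝ E] [FiniteDimensional ℝ E]
  {ε : ℝ}

theorem hasCompactSupport_profile_comp (ε : ℝ) (φ : Profile) :
    HasCompactSupport fun x : E ↦ φ ((1 - ‖x‖ ^ 2) / ε) := by
  refine .intro (isCompact_closedBall (0 : E) (1 + 2 * |ε|)) fun x hx ↦ ?_
  refine φ.zero_on_compl fun hv ↦ hx ?_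
  have hε : ε ≠ 0 := by
    rintro rfl
    simpa using pos_of_mem_dyadicInterval hv
  have bound : |1 - ‖x‖ ^ 2| ≤ 2 * |ε| := by
    rw [← div_le_iff₀ (abs_pos.2 hε), ← abs_div]
    exact (abs_of_pos (pos_of_mem_dyadicInterval hv)).trans_le hv.2
  rw [mem_closedBall_zero_iff]
  nlinarith [(abs_le.1 bound).1, abs_nonneg ε, norm_nonneg x]

variable (E) in
/-- The function `x ↦ φ ((1 - |x|²) / ε)`, which for `ε > 0` lives in the part of the unit ball at
distance comparable to `ε` from the sphere. -/
noncomputable def annulusFun (ε : ℝ) : Profile →ₗ[ℂ] 𝓢(E, ℂ) where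
  toFun φ := (hasCompactSupport_profile_comp ε φ).toSchwartzMap
    (φ.contDiff.comp ((contDiff_const.sub (contDiff_norm_sq ℝ)).div_const ε))
  map_add' _ _ := rfl
  map_smul' _ _ := rfl

theorem annulusFun_apply (ε : ℝ) (φ : Profile) (x : E) :
    annulusFun E ε φ x = φ ((1 - ‖x‖ ^ 2) / ε) := rfl

theorem sub_laplacian_annulusFun (hε : ε ≠ 0) (φ : Profile) :
    annulusFun E ε φ - Δ (annulusFun E ε φ) =
      ((ε : ℂ) ^ 2)⁻¹ • annulusFun E ε (scaledBessel (Module.finrank ℝ E) ε derivative φ) := by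
  have hasDerivAt_rescaled (ψ : Profile) (r : ℝ) :
      HasDerivAt (fun r ↦ ψ ((1 - r) / ε)) (-(ε : ℂ)⁻¹ * derivative ψ ((1 - r) / ε)) r := by
    convert! (hasDerivAt ψ _).scomp r (((hasDerivAt_id r).const_sub 1).div_const ε) using 1
    simp [neg_div]
  ext x
  have hε' : (ε : ℂ) ≠ 0 := Complex.ofReal_ne_zero.2 hε
  rw [_root_.sub_apply, _root_.smul_apply,
    laplacian_of_forall_eq_comp_norm_sq (annulusFun_apply ε φ) (hasDerivAt_rescaled φ)
      fun r ↦ (hasDerivAt_rescaled (derivative φ) r).const_mul _,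
    annulusFun_apply, annulusFun_apply]
  simp only [scaledBessel_apply, smul_eq_mul]
  push_cast
  field_simp
  ring

end Annulus

section AnnulusNorm

open Function Set Metric Module Profile
open scoped Distributions

variable {E : Type*} [NormedAddCommGroup E] [InnerProductSpace ℝ E] [FiniteDimensional ℝ E]
  {ε : ℝ}

theorem support_annulusFun_subset (hε : 0 < ε) (φ : Profile) :
    support (annulusFun E ε φ) ⊆ ball 0 1 \ ball 0 (1 - 2 * ε) := by
  intro x hx
  have hv : (1 - ‖x‖ ^ 2) / ε ∈ dyadicInterval := by
    contrapose! hx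
    exact notMem_support.2 (φ.zero_on_compl hx)
  have upper : 1 - ‖x‖ ^ 2 ≤ 2 * ε := (div_le_iff₀ hε).1 hv.2
  have lower : 0 < 1 - ‖x‖ ^ 2 := (div_pos_iff_of_pos_right hε).1 (pos_of_mem_dyadicInterval hv)
  rw [mem_sdiff, mem_ball_zero_iff, mem_ball_zero_iff, not_lt]
  constructor <;> nlinarith [norm_nonneg x]

variable [MeasurableSpace E] [BorelSpace E]

theorem addHaar_ball_diff_ball_one_sub_le (μ : Measure E) [μ.IsAddHaarMeasure] {t : ℝ}
    (ht : 0 ≤ t) :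
    μ (ball 0 1 \ ball 0 (1 - t)) ≤ ENNReal.ofReal ((finrank ℝ E + 1) * t) * μ (ball 0 1) := by
  rcases le_or_gt 1 t with ht₁ | ht₁
  · refine (measure_mono sdiff_subset).trans (le_mul_of_one_le_left' ?_)
    rw [ENNReal.one_le_ofReal]
    nlinarith [(finrank ℝ E).cast_nonneg (α := ℝ)]
  · have bernoulli : 1 - (1 - t) ^ finrank ℝ E ≤ (finrank ℝ E + 1) * t := by
      have := one_add_mul_le_pow (a := -t) (by linarith) (finrank ℝ E)
      rw [← sub_eq_add_neg] at this
      linarith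
    rw [measure_sdiff (ball_subset_ball (by linarith)) measurableSet_ball.nullMeasurableSet
      measure_ball_lt_top.ne, Measure.addHaar_ball_of_pos μ 0 (sub_pos.2 ht₁)]
    nth_rw 1 [← one_mul (μ (ball 0 1))]
    rw [← ENNReal.sub_mul fun _ _ ↦ measure_ball_lt_top.ne, ← ENNReal.ofReal_one,
      ← ENNReal.ofReal_sub _ (pow_nonneg (sub_pos.2 ht₁).le _)]
    gcongr

theorem eLpNorm_annulusFun_le (hε : 0 < ε) (φ : Profile) (q : ℝ≥0∞) :
    eLpNorm (annulusFun E ε φ) q ≤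
      ENNReal.ofReal ((2 * (finrank ℝ E + 1) * volume.real (ball (0 : E) 1) * ε) ^ (q⁻¹).toReal *
        N[ℂ]_{dyadicInterval, 0} φ) := by
  have bound (x : E) : ‖annulusFun E ε φ x‖ ≤ N[ℂ]_{dyadicInterval, 0} φ :=
    ContDiffMapSupportedIn.norm_apply_le_seminorm ℂ
  have volume_le : volume (ball (0 : E) 1 \ ball 0 (1 - 2 * ε)) ≤
      ENNReal.ofReal (2 * (finrank ℝ E + 1) * volume.real (ball (0 : E) 1) * ε) := by
    refine (addHaar_ball_diff_ball_one_sub_le volume (by positivity)).trans_eq ?_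
    rw [← ofReal_measureReal measure_ball_lt_top.ne, ← ENNReal.ofReal_mul (by positivity)]
    ring_nf
  rw [← eLpNorm_restrict_eq_of_support_subset (support_annulusFun_subset hε φ),
    ENNReal.ofReal_mul (by positivity)]
  refine (eLpNorm_le_of_ae_bound (.of_forall bound)).trans ?_
  rw [Measure.restrict_apply_univ, ← ENNReal.toReal_inv]
  gcongr
  exact (ENNReal.rpow_le_rpow volume_le ENNReal.toReal_nonneg).trans_eq
    (ENNReal.ofReal_rpow_of_nonneg (by positivity) ENNReal.toReal_nonneg)

end AnnulusNorm

section AnnulusBessel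

open Profile
open scoped Laplacian Distributions

variable {n : ℕ} {ε : ℝ} {q : ℝ≥0∞}

theorem schwartzBessel_two (f : 𝓢(EuclideanSpace ℝ (Fin n), ℂ)) :
    schwartzBessel n 2 f = f - Δ f := by
  have fourier_laplacian : 𝓕 (Δ f) = (-(2 * Real.pi) ^ 2 : ℝ) • SchwartzMap.smulLeftCLM ℂ
      (fun ξ : EuclideanSpace ℝ (Fin n) ↦ ‖ξ‖ ^ 2) (𝓕 f) := by
    rw [SchwartzMap.laplacian_eq_fourierMultiplierCLM, FourierTransform.fourier_smul,
      SchwartzMap.fourierMultiplierCLM_apply, FourierTransform.fourier_fourierInv_eq]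
  refine (FourierTransform.fourierEquiv ℂ 𝓢(EuclideanSpace ℝ (Fin n), ℂ)).injective ?_
  ext ξ
  rw [map_sub]
  simp only [FourierTransform.fourierEquiv_apply, fourier_laplacian, fourier_schwartzBessel,
    besselSymbol_two, sub_apply, smul_apply, SchwartzMap.smulLeftCLM_apply_apply
      (show (fun ξ : EuclideanSpace ℝ (Fin n) ↦ ‖ξ‖ ^ 2).HasTemperateGrowth by fun_prop),
    Complex.real_smul]
  push_cast
  ring

theorem schwartzBessel_two_annulusFun (hε : ε ≠ 0) (φ : Profile) :
    schwartzBessel n 2 (annulusFun _ ε φ) =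
      ((ε : ℂ) ^ 2)⁻¹ • annulusFun _ ε (scaledBessel n ε derivative φ) := by
  rw [schwartzBessel_two, sub_laplacian_annulusFun hε, finrank_euclideanSpace_fin]

theorem schwartzBessel_two_mul_annulusFun (hε : ε ≠ 0) (φ : Profile) (j : ℕ) :
    schwartzBessel n (2 * j) (annulusFun _ ε φ) =
      ((ε : ℂ) ^ (2 * j))⁻¹ • annulusFun _ ε ((scaledBessel n ε derivative ^ j) φ) := by
  induction j with
  | zero => simp [schwartzBessel_zero]
  | succ j ih =>
    rw [Nat.cast_succ, mul_add_one, add_comm, schwartzBessel_add, ih, map_smul,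
      schwartzBessel_two_annulusFun hε, smul_smul, ← mul_inv, ← pow_add, mul_add_one,
      pow_succ' (scaledBessel _ _ _), Module.End.mul_apply]

theorem exists_eLpNorm_schwartzBessel_two_mul_annulusFun_le (n j : ℕ) (φ : Profile) (q : ℝ≥0∞) :
    ∃ C : ℝ, 0 ≤ C ∧ ∀ (δ : ℂ) (ε : ℝ), 0 < ε → ε ≤ 1 →
      eLpNorm (schwartzBessel n (2 * j) (annulusFun _ ε (cpowMul δ φ))) q ≤
        ENNReal.ofReal (C * 2 ^ |δ.re| * ε ^ (q⁻¹).toReal * ((1 + ‖δ‖) / ε) ^ (2 * j)) := by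
  obtain ⟨C, hC⟩ := exists_seminorm_scaledBessel_pow_le N[ℂ]_{dyadicInterval, 0} n j φ
  have hC₀ : 0 ≤ C := by
    simpa using (apply_nonneg N[ℂ]_{dyadicInterval, 0} _).trans (hC 0 0 le_rfl zero_le_one)
  set K : ℝ := 2 * (n + 1) * volume.real (Metric.ball (0 : EuclideanSpace ℝ (Fin n)) 1)
  refine ⟨K ^ (q⁻¹).toReal * C, by positivity, fun δ ε hε hε₁ ↦ ?_⟩
  have norm_le : N[ℂ]_{dyadicInterval, 0} ((scaledBessel n ε derivative ^ j) (cpowMul δ φ)) ≤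
      2 ^ |δ.re| * (C * (1 + ‖δ‖) ^ (2 * j)) := by
    rw [← Module.End.mul_apply,
      ← ((semiconjBy_cpowMul_scaledBessel n δ ε).pow_right j).eq, Module.End.mul_apply]
    refine (seminorm_cpowMul_le _ _).trans ?_
    gcongr
    exact hC δ ε hε.le hε₁
  have norm_inv : ‖((ε : ℂ) ^ (2 * j))⁻¹‖ = (ε ^ (2 * j))⁻¹ := by
    rw [norm_inv, norm_pow, Complex.norm_real, Real.norm_of_nonneg hε.le]
  rw [schwartzBessel_two_mul_annulusFun hε.ne', FunLike.coe_smul, eLpNorm_const_smul, ← ofReal_norm,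
    norm_inv]
  refine (mul_le_mul_right (eLpNorm_annulusFun_le hε _ q) _).trans ?_
  rw [finrank_euclideanSpace_fin, ← ENNReal.ofReal_mul (by positivity),
    Real.mul_rpow (by positivity) hε.le]
  refine ENNReal.ofReal_le_ofReal ?_
  calc (ε ^ (2 * j))⁻¹ * (K ^ (q⁻¹).toReal * ε ^ (q⁻¹).toReal *
        N[ℂ]_{dyadicInterval, 0} ((scaledBessel n ε derivative ^ j) (cpowMul δ φ)))
      ≤ (ε ^ (2 * j))⁻¹ * (K ^ (q⁻¹).toReal * ε ^ (q⁻¹).toReal *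
        (2 ^ |δ.re| * (C * (1 + ‖δ‖) ^ (2 * j)))) := by gcongr
    _ = _ := by rw [div_pow]; ring

theorem eLpNorm_schwartzBessel_le_of_le {a B M : ℝ} (ha : 0 ≤ a) (ha₁ : a < 1) (hB : 0 ≤ B)
    (hM : 0 < M) (hq : 1 ≤ q) {f : 𝓢(EuclideanSpace ℝ (Fin n), ℂ)}
    (h₀ : eLpNorm f q ≤ ENNReal.ofReal B)
    (h₂ : eLpNorm (schwartzBessel n 2 f) q ≤ ENNReal.ofReal (B * M ^ 2)) :
    eLpNorm (schwartzBessel n (2 * a) f) q ≤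
      ENNReal.ofReal ((Real.Gamma (1 - a))⁻¹ * ((1 - a)⁻¹ + 2) * B * M ^ (2 * a)) := by
  rcases ha.eq_or_lt with rfl | ha
  · rw [mul_zero, schwartzBessel_zero]
    refine h₀.trans (ENNReal.ofReal_le_ofReal ?_)
    rw [sub_zero, Real.Gamma_one, inv_one, Real.rpow_zero]
    linarith
  have ha' : 0 < 1 - a := sub_pos.2 ha₁
  have hΓ : 0 < Real.Gamma (1 - a) := Real.Gamma_pos_of_pos ha'
  have hM₂ : (M ^ (-2 : ℝ)) ^ (1 - a) * M ^ 2 = M ^ (2 * a) := by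
    rw [← Real.rpow_natCast, ← Real.rpow_mul hM.le, ← Real.rpow_add hM]
    congr 1
    push_cast
    ring
  have hM₀ : (M ^ (-2 : ℝ)) ^ (-a) = M ^ (2 * a) := by
    rw [← Real.rpow_mul hM.le, neg_mul_neg]
  -- The splitting time `T = M⁻²` balances the contributions of `f` and `(I - Δ) f`.
  have interpolated := eLpNorm_schwartzBessel_le ha ha₁ (Real.rpow_pos_of_pos hM (-2)) hq f
  rw [ENNReal.mul_le_iff_le_inv (ENNReal.ofReal_pos.2 hΓ).ne' ENNReal.ofReal_ne_top,
    ← ENNReal.ofReal_inv_of_pos hΓ] at interpolated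
  refine interpolated.trans ((mul_le_mul_right (add_le_add (mul_le_mul_right h₂ _)
    (mul_le_mul_right (mul_le_mul_right h₀ _) _)) _).trans_eq ?_)
  rw [← ENNReal.ofReal_ofNat 2, ← ENNReal.ofReal_mul (by positivity),
    ← ENNReal.ofReal_mul (by positivity), ← ENNReal.ofReal_mul zero_le_two,
    ← ENNReal.ofReal_add (by positivity) (by positivity), ← ENNReal.ofReal_mul (by positivity),
    hM₀, ← hM₂]
  congr 1
  ring

theorem exists_eLpNorm_schwartzBessel_annulusFun_le (n : ℕ) {s : ℝ} (hs : 0 ≤ s) (φ : Profile)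
    (hq : 1 ≤ q) :
    ∃ C : ℝ, 0 ≤ C ∧ ∀ (δ : ℂ) (ε : ℝ), 0 < ε → ε ≤ 1 →
      eLpNorm (schwartzBessel n s (annulusFun _ ε (cpowMul δ φ))) q ≤
        ENNReal.ofReal (C * 2 ^ |δ.re| * ε ^ (q⁻¹).toReal * ((1 + ‖δ‖) / ε) ^ s) := by
  set j := ⌊s / 2⌋₊
  set a := s / 2 - j with ha_def
  have ha : 0 ≤ a := sub_nonneg.2 (Nat.floor_le (by positivity))
  have ha₁ : a < 1 := sub_lt_iff_lt_add'.2 (Nat.lt_floor_add_one _)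
  have constant_nonneg : 0 ≤ (Real.Gamma (1 - a))⁻¹ * ((1 - a)⁻¹ + 2) :=
    mul_nonneg (inv_nonneg.2 (Real.Gamma_nonneg_of_nonneg (sub_pos.2 ha₁).le))
      (add_nonneg (inv_nonneg.2 (sub_pos.2 ha₁).le) zero_le_two)
  obtain ⟨C₀, hC₀, h₀⟩ := exists_eLpNorm_schwartzBessel_two_mul_annulusFun_le n j φ q
  obtain ⟨C₂, hC₂, h₂⟩ := exists_eLpNorm_schwartzBessel_two_mul_annulusFun_le n (j + 1) φ q
  refine ⟨(Real.Gamma (1 - a))⁻¹ * ((1 - a)⁻¹ + 2) * (C₀ + C₂),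
    mul_nonneg constant_nonneg (add_nonneg hC₀ hC₂), fun δ ε hε hε₁ ↦ ?_⟩
  set M := (1 + ‖δ‖) / ε
  set B := (C₀ + C₂) * 2 ^ |δ.re| * ε ^ (q⁻¹).toReal * M ^ (2 * j) with hB
  set f := annulusFun (EuclideanSpace ℝ (Fin n)) ε (cpowMul δ φ)
  have hM : 0 < M := by positivity
  have bound₀ : eLpNorm (schwartzBessel n (2 * j) f) q ≤ ENNReal.ofReal B := by
    rw [hB]
    refine (h₀ δ ε hε hε₁).trans (ENNReal.ofReal_le_ofReal ?_)
    gcongr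
    exact le_add_of_nonneg_right hC₂
  have bound₂ : eLpNorm (schwartzBessel n 2 (schwartzBessel n (2 * j) f)) q ≤
      ENNReal.ofReal (B * M ^ 2) := by
    rw [← schwartzBessel_add, add_comm, ← mul_add_one, ← Nat.cast_succ, hB, mul_assoc _ (M ^ _),
      ← pow_add, ← mul_add_one]
    refine (h₂ δ ε hε hε₁).trans (ENNReal.ofReal_le_ofReal ?_)
    gcongr
    exact le_add_of_nonneg_left hC₀
  have interpolated := eLpNorm_schwartzBessel_le_of_le ha ha₁ (by positivity) hM hq bound₀ bound₂
  have hs_eq : 2 * a + 2 * j = s := by rw [ha_def]; ring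
  rw [← schwartzBessel_add, hs_eq] at interpolated
  refine interpolated.trans_eq (congrArg ENNReal.ofReal ?_)
  rw [← hs_eq, Real.rpow_add hM, hB, ← Real.rpow_natCast M]
  push_cast
  ring

end AnnulusBessel

section DyadicDecomposition

open Set Filter Profile
open scoped Topology ContDiff Distributions

/-- A smooth function equal to `1` on `(-∞, 1]` and to `0` on `[2, ∞)`. -/
noncomputable def stepDown (v : ℝ) : ℝ := Real.smoothTransition (2 - v)

theorem contDiff_stepDown : ContDiff ℝ ∞ stepDown :=
  Real.smoothTransition.contDiff.comp (contDiff_const.sub contDiff_id)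

theorem stepDown_of_le_one {v : ℝ} (hv : v ≤ 1) : stepDown v = 1 :=
  Real.smoothTransition.one_of_one_le (by linarith)

theorem stepDown_of_two_le {v : ℝ} (hv : 2 ≤ v) : stepDown v = 0 :=
  Real.smoothTransition.zero_of_nonpos (by linarith)

/-- The profile whose dilates by the powers of `2` form a partition of unity on `(0, 1]`. -/
noncomputable def dyadicCutoff : Profile :=
  .of_support_subset (f := fun v ↦ ((stepDown v - stepDown (2 * v) : ℝ) : ℂ))
    (Complex.ofRealCLM.contDiff.comp
      (contDiff_stepDown.sub (contDiff_stepDown.comp (contDiff_const.mul contDiff_id)))) <| by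
    refine Function.support_subset_iff'.2 fun v hv ↦ ?_
    rcases lt_or_ge v (1 / 2) with lt_half | half_le
    · rw [stepDown_of_le_one (by linarith), stepDown_of_le_one (by linarith), sub_self,
        Complex.ofReal_zero]
    · have two_lt : 2 < v := not_le.1 fun le_two ↦ hv ⟨half_le, le_two⟩
      rw [stepDown_of_two_le two_lt.le, stepDown_of_two_le (by linarith), sub_self,
        Complex.ofReal_zero]

theorem dyadicCutoff_apply (v : ℝ) :
    dyadicCutoff v = ((stepDown v - stepDown (2 * v) : ℝ) : ℂ) := rfl

theorem sum_dyadicCutoff (u : ℝ) (K : ℕ) :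
    ∑ k ∈ Finset.range K, dyadicCutoff (u / (1 / 2) ^ k) =
      ((stepDown u - stepDown (2 ^ K * u) : ℝ) : ℂ) := by
  have telescoping (k : ℕ) : dyadicCutoff (u / (1 / 2) ^ k) =
      ((stepDown (2 ^ k * u) - stepDown (2 ^ (k + 1) * u) : ℝ) : ℂ) := by
    rw [dyadicCutoff_apply, one_div, inv_pow, div_inv_eq_mul, mul_comm u, ← mul_assoc, ← pow_succ']
  simp only [telescoping, ← Complex.ofReal_sum]
  rw [Finset.sum_range_sub' fun k ↦ stepDown (2 ^ k * u), pow_zero, one_mul]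

theorem tendsto_sum_dyadicCutoff {u : ℝ} (hu : 0 < u) (hu₁ : u ≤ 1) :
    Tendsto (fun K ↦ ∑ k ∈ Finset.range K, dyadicCutoff (u / (1 / 2) ^ k)) atTop (𝓝 1) := by
  have dilate_atTop : Tendsto (fun K : ℕ ↦ (2 : ℝ) ^ K * u) atTop atTop :=
    (tendsto_pow_atTop_atTop_of_one_lt one_lt_two).atTop_mul_const hu
  refine tendsto_const_nhds.congr' ?_
  filter_upwards [dilate_atTop.eventually_ge_atTop 2] with K hK
  rw [sum_dyadicCutoff, stepDown_of_le_one hu₁, stepDown_of_two_le hK, sub_zero,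
    Complex.ofReal_one]

variable {n : ℕ} {q : ℝ≥0∞}

/-- The part of `(1 - |x|²)_+^δ` at distance comparable to `2⁻ᵏ` from the unit sphere. -/
noncomputable def dyadicPiece (n : ℕ) (δ : ℂ) (k : ℕ) : 𝓢(EuclideanSpace ℝ (Fin n), ℂ) :=
  (((1 / 2) ^ k : ℝ) : ℂ) ^ δ • annulusFun _ ((1 / 2) ^ k) (cpowMul δ dyadicCutoff)

theorem dyadicPiece_apply (δ : ℂ) (k : ℕ) (x : EuclideanSpace ℝ (Fin n)) :
    dyadicPiece n δ k x = ballPower n δ x * dyadicCutoff ((1 - ‖x‖ ^ 2) / (1 / 2) ^ k) := by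
  have scale_pos : (0 : ℝ) < (1 / 2) ^ k := by positivity
  rw [dyadicPiece, smul_apply, annulusFun_apply, cpowMul_apply, smul_eq_mul, ballPower]
  split_ifs with hx
  · have hu : 0 ≤ 1 - ‖x‖ ^ 2 := by nlinarith [norm_nonneg x]
    rw [← mul_assoc, ← Complex.mul_cpow_ofReal_nonneg scale_pos.le (by positivity),
      ← Complex.ofReal_mul, mul_div_cancel₀ _ scale_pos.ne']
  · have hu : 1 - ‖x‖ ^ 2 ≤ 0 := by nlinarith
    rw [dyadicCutoff.zero_on_compl fun h ↦
      (pos_of_mem_dyadicInterval h).not_ge (div_nonpos_of_nonpos_of_nonneg hu scale_pos.le)]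
    simp

theorem tendsto_sum_dyadicPiece (δ : ℂ) (x : EuclideanSpace ℝ (Fin n)) :
    Tendsto (fun K ↦ ∑ k ∈ Finset.range K, dyadicPiece n δ k x) atTop
      (𝓝 (ballPower n δ x)) := by
  simp only [dyadicPiece_apply, ← Finset.mul_sum]
  by_cases hx : ‖x‖ < 1
  · have partition_of_unity := tendsto_sum_dyadicCutoff (u := 1 - ‖x‖ ^ 2)
      (by nlinarith [norm_nonneg x]) (by nlinarith)
    simpa only [mul_one] using partition_of_unity.const_mul (ballPower n δ x)
  · simp only [ballPower, if_neg hx, zero_mul, tendsto_const_nhds]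

theorem exists_eLpNorm_schwartzBessel_dyadicPiece_le (n : ℕ) {s : ℝ} (hs : 0 ≤ s) (hq : 1 ≤ q) :
    ∃ C : ℝ, 0 ≤ C ∧ ∀ (δ : ℂ) (k : ℕ), eLpNorm (schwartzBessel n s (dyadicPiece n δ k)) q ≤
      ENNReal.ofReal (C * 2 ^ |δ.re| * (1 + ‖δ‖) ^ s *
        ((1 / 2) ^ (δ.re + (q⁻¹).toReal - s)) ^ k) := by
  obtain ⟨C, hC, bound⟩ := exists_eLpNorm_schwartzBessel_annulusFun_le n hs dyadicCutoff hq
  refine ⟨C, hC, fun δ k ↦ ?_⟩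
  have scale_pos : (0 : ℝ) < (1 / 2) ^ k := by positivity
  have scale_le_one : (1 / 2 : ℝ) ^ k ≤ 1 := pow_le_one₀ (by norm_num) (by norm_num)
  rw [dyadicPiece, map_smul, FunLike.coe_smul, eLpNorm_const_smul, ← ofReal_norm,
    Complex.norm_cpow_eq_rpow_re_of_pos scale_pos]
  refine (mul_le_mul_right (bound δ _ scale_pos scale_le_one) _).trans_eq ?_
  rw [← ENNReal.ofReal_mul (by positivity), Real.rpow_pow_comm (by norm_num),
    Real.rpow_sub scale_pos, Real.rpow_add scale_pos, Real.div_rpow (by positivity) scale_pos.le]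
  congr 1
  ring

end DyadicDecomposition

section SobolevSum

open Filter
open scoped Topology

variable {n : ℕ} {s : ℝ} {q : ℝ≥0∞}

theorem norm_toLp_le {f : 𝓢(EuclideanSpace ℝ (Fin n), ℂ)} {r : ℝ} (hr : 0 ≤ r)
    (h : eLpNorm f q ≤ ENNReal.ofReal r) : ‖f.toLp q‖ ≤ r := by
  rw [SchwartzMap.norm_toLp]
  exact ENNReal.toReal_le_of_le_ofReal hr h

variable [Fact (1 ≤ q)] {S : ℕ → 𝓢(EuclideanSpace ℝ (Fin n), ℂ)}
  {f : EuclideanSpace ℝ (Fin n) → ℂ}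

theorem besselOp_toLp (s : ℝ) (q : ℝ≥0∞) [Fact (1 ≤ q)] (f : 𝓢(EuclideanSpace ℝ (Fin n), ℂ)) :
    besselOp n s (Lp.toTemperedDistribution (f.toLp q)) =
      Lp.toTemperedDistribution ((schwartzBessel n s f).toLp q) := by
  rw [Lp.toTemperedDistribution_toLp_eq, Lp.toTemperedDistribution_toLp_eq]
  exact TemperedDistribution.fourierMultiplierCLM_toTemperedDistributionCLM_eq
    (besselSymbol_hasTemperateGrowth n s) f

theorem ae_eq_of_hasSum_toLp {F : Lp ℂ q (volume : Measure (EuclideanSpace ℝ (Fin n)))}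
    (hF : HasSum (fun k ↦ (S k).toLp q) F)
    (hf : ∀ x, Tendsto (fun K ↦ ∑ k ∈ Finset.range K, S k x) atTop (𝓝 (f x))) :
    F =ᵐ[volume] f := by
  obtain ⟨subseq, subseq_strictMono, subseq_tendsto⟩ :=
    (tendstoInMeasure_of_tendsto_Lp hF.tendsto_sum_nat).exists_seq_tendsto_ae
  have partial_sum (K : ℕ) : ⇑(∑ k ∈ Finset.range K, (S k).toLp q : Lp ℂ q volume) =ᵐ[volume]
      fun x ↦ ∑ k ∈ Finset.range K, S k x := by
    have toLp_sum : ∑ k ∈ Finset.range K, (S k).toLp q = (∑ k ∈ Finset.range K, S k).toLp q :=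
      (map_sum (SchwartzMap.toLpCLM ℂ ℂ q volume) S (Finset.range K)).symm
    rw [toLp_sum]
    filter_upwards [(∑ k ∈ Finset.range K, S k).coeFn_toLp q] with x hx
    rw [hx, sum_apply]
  filter_upwards [subseq_tendsto, ae_all_iff.2 partial_sum] with x hx hx'
  simp only [hx'] at hx
  exact tendsto_nhds_unique hx ((hf x).comp subseq_strictMono.tendsto_atTop)

theorem isBesselImage_of_hasSum
    (hf : ∀ x, Tendsto (fun K ↦ ∑ k ∈ Finset.range K, S k x) atTop (𝓝 (f x)))
    (hS : Summable fun k ↦ (S k).toLp q)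
    {G : Lp ℂ q (volume : Measure (EuclideanSpace ℝ (Fin n)))}
    (hG : HasSum (fun k ↦ (schwartzBessel n s (S k)).toLp q) G) :
    IsBesselImage n s q f G := by
  obtain ⟨F, hF⟩ := hS
  have ae_eq := ae_eq_of_hasSum_toLp hF hf
  have memLp : MemLp f q volume := (memLp_congr_ae ae_eq).1 (Lp.memLp F)
  have toLp_eq : memLp.toLp f = F := by
    rw [← Lp.toLp_coeFn F (Lp.memLp F)]
    exact MemLp.toLp_congr _ _ ae_eq.symm
  refine ⟨memLp, ?_⟩
  have sum_bessel := (hF.mapL (Lp.toTemperedDistributionCLM ℂ volume q)).mapL (besselOp n s)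
  have sum_image := hG.mapL (Lp.toTemperedDistributionCLM ℂ volume q)
  simp only [Lp.toTemperedDistributionCLM_apply, besselOp_toLp] at sum_bessel sum_image
  rw [toLp_eq]
  exact sum_bessel.unique sum_image

theorem memSobolevW_and_sobolevNormW_le_of_hasSum {a b : ℕ → ℝ} {B : ℝ}
    (hf : ∀ x, Tendsto (fun K ↦ ∑ k ∈ Finset.range K, S k x) atTop (𝓝 (f x)))
    (ha : ∀ k, 0 ≤ a k) (hSa : ∀ k, eLpNorm (S k) q ≤ ENNReal.ofReal (a k)) (ha_sum : Summable a)
    (hb : ∀ k, 0 ≤ b k) (hSb : ∀ k, eLpNorm (schwartzBessel n s (S k)) q ≤ ENNReal.ofReal (b k))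
    (hb_sum : HasSum b B) :
    MemSobolevW n s q f ∧ sobolevNormW n s q f ≤ ENNReal.ofReal B := by
  have norm_le (k : ℕ) : ‖(S k).toLp q‖ ≤ a k := norm_toLp_le (ha k) (hSa k)
  have norm_bessel_le (k : ℕ) : ‖(schwartzBessel n s (S k)).toLp q‖ ≤ b k :=
    norm_toLp_le (hb k) (hSb k)
  have summable : Summable fun k ↦ (S k).toLp q := .of_norm_bounded ha_sum norm_le
  have summable_bessel : Summable fun k ↦ (schwartzBessel n s (S k)).toLp q :=
    .of_norm_bounded hb_sum.summable norm_bessel_le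
  have image := isBesselImage_of_hasSum hf summable summable_bessel.hasSum
  refine ⟨⟨_, image⟩, ?_⟩
  rw [sobolevNormW_eq image, ← ofReal_norm]
  exact ENNReal.ofReal_le_ofReal (tsum_of_norm_bounded hb_sum norm_bessel_le)

theorem exists_memSobolevW_and_sobolevNormW_ballPower_le (n : ℕ) (q : ℝ≥0∞) [Fact (1 ≤ q)]
    (hs : 0 ≤ s) :
    ∃ C : ℝ, 0 ≤ C ∧ ∀ δ : ℂ, s < δ.re + (q⁻¹).toReal →
      MemSobolevW n s q (ballPower n δ) ∧
      sobolevNormW n s q (ballPower n δ) ≤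
        ENNReal.ofReal (C * 2 ^ |δ.re| * (1 + ‖δ‖) ^ s *
          (1 - (1 / 2) ^ (δ.re + (q⁻¹).toReal - s))⁻¹) := by
  obtain ⟨C₀, hC₀, bound₀⟩ := exists_eLpNorm_schwartzBessel_dyadicPiece_le n le_rfl
    (Fact.out : 1 ≤ q)
  obtain ⟨C, hC, bound⟩ := exists_eLpNorm_schwartzBessel_dyadicPiece_le n hs (Fact.out : 1 ≤ q)
  simp only [schwartzBessel_zero, sub_zero] at bound₀
  refine ⟨C, hC, fun δ hδ ↦ ?_⟩
  have ratio_lt_one {e : ℝ} (he : 0 < e) : (1 / 2 : ℝ) ^ e < 1 :=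
    Real.rpow_lt_one (by norm_num) (by norm_num) he
  refine memSobolevW_and_sobolevNormW_le_of_hasSum (tendsto_sum_dyadicPiece δ)
    (fun k ↦ by positivity) (bound₀ δ) ?_ (fun k ↦ by positivity) (bound δ) ?_
  · exact (summable_geometric_of_lt_one (by positivity) (ratio_lt_one (hs.trans_lt hδ))).mul_left _
  · exact (hasSum_geometric_of_lt_one (by positivity) (ratio_lt_one (sub_pos.2 hδ))).mul_left _

theorem one_add_norm_le_of_abs_re_le {δ : ℂ} {m : ℝ} (h : |δ.re| ≤ m) :
    1 + ‖δ‖ ≤ (1 + m) * (1 + |δ.im|) := by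
  have norm_le := Complex.norm_le_abs_re_add_abs_im δ
  nlinarith [mul_nonneg ((abs_nonneg _).trans h) (abs_nonneg δ.im)]

theorem exists_sobolevNormW_ballPower_le_rpow (n : ℕ) (q : ℝ≥0∞) [Fact (1 ≤ q)] (hs : 0 ≤ s)
    (m : ℝ) {e : ℝ} (he : 0 < e) :
    ∃ C : ℝ, 0 < C ∧ ∀ δ : ℂ, |δ.re| ≤ m → s + e ≤ δ.re + (q⁻¹).toReal →
      sobolevNormW n s q (ballPower n δ) ≤ ENNReal.ofReal (C * (1 + |δ.im|) ^ s) := by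
  obtain ⟨C, hC, bound⟩ := exists_memSobolevW_and_sobolevNormW_ballPower_le n q hs
  have geometric_pos : 0 < 1 - (1 / 2 : ℝ) ^ e :=
    sub_pos.2 (Real.rpow_lt_one (by norm_num) (by norm_num) he)
  refine ⟨(C + 1) * 2 ^ m * (1 + |m|) ^ s * (1 - (1 / 2) ^ e)⁻¹, by positivity,
    fun δ hδ exponent_le ↦ ?_⟩
  have ratio_le : (1 / 2 : ℝ) ^ (δ.re + (q⁻¹).toReal - s) ≤ (1 / 2) ^ e :=
    Real.rpow_le_rpow_of_exponent_ge (by norm_num) (by norm_num) (by linarith)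
  have geometric_le :
      (1 - (1 / 2 : ℝ) ^ (δ.re + (q⁻¹).toReal - s))⁻¹ ≤ (1 - (1 / 2 : ℝ) ^ e)⁻¹ :=
    inv_anti₀ geometric_pos (by linarith)
  have norm_le : 1 + ‖δ‖ ≤ (1 + |m|) * (1 + |δ.im|) :=
    one_add_norm_le_of_abs_re_le (hδ.trans (le_abs_self m))
  refine (bound δ (by linarith)).2.trans (ENNReal.ofReal_le_ofReal ?_)
  calc C * 2 ^ |δ.re| * (1 + ‖δ‖) ^ s * (1 - (1 / 2) ^ (δ.re + (q⁻¹).toReal - s))⁻¹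
      ≤ (C + 1) * 2 ^ m * ((1 + |m|) * (1 + |δ.im|)) ^ s * (1 - (1 / 2) ^ e)⁻¹ := by
        refine mul_le_mul ?_ geometric_le (inv_nonneg.2 (by linarith)) (by positivity)
        gcongr
        · linarith
        · exact one_le_two
    _ = (C + 1) * 2 ^ m * (1 + |m|) ^ s * (1 - (1 / 2) ^ e)⁻¹ * (1 + |δ.im|) ^ s := by
        rw [Real.mul_rpow (by positivity) (by positivity)]
        ring

end SobolevSum

theorem one_add_rpow_le_exp {s t : ℝ} (hs : 0 ≤ s) (ht : 0 ≤ t) :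
    (1 + t) ^ s ≤ Real.exp (s * t) := by
  rw [mul_comm, Real.exp_mul, add_comm]
  exact Real.rpow_le_rpow (by positivity) (Real.add_one_le_exp t) hs

end BochnerRiesz

theorem mainTheorem10_general (n : ℕ) (q : ℝ≥0∞) [Fact (1 ≤ q)] (s : ℝ) (hs : 0 ≤ s) :
    (∀ δ : ℂ, s < δ.re + (q⁻¹).toReal →
      BochnerRiesz.MemSobolevW n s q (BochnerRiesz.ballPower n δ)) ∧
    ∀ σ₀ c' : ℝ, s < σ₀ + (q⁻¹).toReal →
      ∃ C : ℝ, 0 < C ∧ ∀ σ τ : ℝ, σ₀ ≤ σ → σ ≤ c' →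
        BochnerRiesz.sobolevNormW n s q (BochnerRiesz.ballPower n (σ + τ * Complex.I)) ≤
          ENNReal.ofReal (C * (1 + |τ|) ^ s) := by
  refine ⟨fun δ hδ ↦ ?_, fun σ₀ c' hσ₀ ↦ ?_⟩
  · obtain ⟨_, -, bound⟩ :=
      BochnerRiesz.exists_memSobolevW_and_sobolevNormW_ballPower_le n q hs
    exact (bound δ hδ).1
  · obtain ⟨C, hC, bound⟩ := BochnerRiesz.exists_sobolevNormW_ballPower_le_rpow n q hs
      (max |σ₀| |c'|) (sub_pos.2 hσ₀)
    refine ⟨C, hC, fun σ τ hσ hσ' ↦ ?_⟩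
    simpa using bound (σ + τ * Complex.I) (by simpa using abs_le_max_abs_abs hσ hσ')
      (by simpa using hσ)

theorem mainTheorem10 (n : ℕ) (hn : 0 < n) (q : ℝ≥0∞) [Fact (1 ≤ q)] (hq : q ≠ ∞)
    (s : ℝ) (hs : 0 < s) :
    (∀ σ τ : ℝ, s < σ + 1 / q.toReal →
      BochnerRiesz.MemSobolevW n s q (BochnerRiesz.ballPower n (σ + τ * Complex.I))) ∧
    ∃ c : ℝ, 0 < c ∧ ∀ σ₀ c' : ℝ, s < σ₀ + 1 / q.toReal →
      ∃ C : ℝ, 0 < C ∧ ∀ σ τ : ℝ, σ₀ ≤ σ → σ ≤ c' →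
        BochnerRiesz.sobolevNormW n s q (BochnerRiesz.ballPower n (σ + τ * Complex.I)) ≤
          ENNReal.ofReal (C * Real.exp (c * |τ|)) := by
  simp only [one_div, ← ENNReal.toReal_inv]
  obtain ⟨mem, bound⟩ := mainTheorem10_general n q s hs.le
  refine ⟨fun σ τ hσ ↦ mem _ (by simpa using hσ), s, hs, fun σ₀ c' hσ₀ ↦ ?_⟩
  obtain ⟨C, hC, norm_le⟩ := bound σ₀ c' hσ₀
  refine ⟨C, hC, fun σ τ hσ hσ' ↦ (norm_le σ τ hσ hσ').trans (ENNReal.ofReal_le_ofReal ?_)⟩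
  gcongr
  exact BochnerRiesz.one_add_rpow_le_exp hs.le (abs_nonneg τ)
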